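/- **Theorem 2 (last-iterate convergence of single-timescale OMWU with random delays).** Consider a zero-sum polymatrix game: a finite undirected graph $(V,\mathcal E)$ of players, finite nonempty action sets $S_i$, payoff matrices $A_{ij}\in\mathbb R^{S_i\times S_j}$ with $A_{ij}=0$ if $(i,j)\notin\mathcal E$, and $\sum_{i\in V}u_i(s)=0$ for every $s\in\prod_i S_i$, where $u_i(s)=\sum_j A_{ij}(s_i,s_j)$. For $\pi=(\pi_i)_{i\in V}$ with $\pi_i\in\Delta(S_i)$ put $A_i\pi=\sum_j A_{ij}\pi_j$, $u_i(\pi)=\pi_i^\top A_i\pi$ and, for $\tau>0$, $u_{i,\tau}(\pi)=u_i(\pi)+\tau\mathcal H(\pi_i)$ with $\mathcal H$ the Shannon entropy. Let $\|A\|_\infty$ be the maximal absolute value of an entry of the payoff matrices, $d_{\max}$ the maximal degree of the graph, $\mathrm{KL}(\pi\|\pi')=\sum_i\mathrm{KL}(\pi_i\|\pi_i')$, and $$\text{QRE-Gap}_\tau(\pi)=\max_{i\in V}\Big[\max_{\pi_i'\in\Delta(S_i)}u_{i,\tau}(\pi_i',\pi_{-i})-u_{i,\tau}(\pi)\Big].$$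 Let $\pi^\star_\tau$ be the quantal response equilibrium: $\pi^\star_{i,\tau}(k)=\exp([A_i\pi^\star_\tau]_k/\tau)\big/\sum_{k'\in S_i}\exp([A_i\pi^\star_\tau]_{k'}/\tau)$ for all $i\in V$, $k\in S_i$. Let the delays $\gamma_i^{(t)}$ ($i\in V$, $t\ge0$) be mutually independent $\mathbb N$-valued random variables, let $E(\ell)$, $\ell\ge 0$, satisfy $$\mathbb E\big[\gamma_i^{(t)}\mathbf 1\{\gamma_i^{(t)}\ge\ell\}\big]\le E(\ell)<\infty\qquad\text{for all } i\in V,\ t\ge 0,\ \ell\ge0,$$ and suppose $L:=\sum_{\ell\ge0}\zeta^\ell E(\ell)<\infty$ for some $\zeta>1$. Put $\kappa_i^{(t)}=\max\{t-\gamma_i^{(t)},0\}$. Single-timescale OMWU starts from $\pi_i^{(0)}=\overline\pi_i^{(0)}$ uniform on $S_i$ and is given, for $t\ge0$, by $$\overline\pi_i^{(t+1)}(k)\propto\pi_i^{(t)}(k)^{1-\eta\tau}\exp\big(\eta[A_i\overline\pi^{(\kappa_i^{(t)})}]_k\big),\qquad \pi_i^{(t+1)}(k)\propto\pi_i^{(t)}(k)^{1-\eta\tau}\exp\big(\eta[A_i\overline\pi^{(\kappa_i^{(t+1)})}]_k\big).$$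 Assume $0<\tau<\min\{1,d_{\max}\|A\|_\infty\}$ and $$0<\eta\le\min\Big\{\frac{\tau}{24d_{\max}^2\|A\|_\infty^2(L+1)},\ \frac{\zeta-1}{\tau\zeta}\Big\}.$$ Then for every $T\ge1$ $$\mathbb E\,\mathrm{KL}(\pi^\star_\tau\|\pi^{(T)})\le(1-\eta\tau)^T\,\mathrm{KL}(\pi^\star_\tau\|\pi^{(0)}),\qquad \mathbb E\,\mathrm{KL}(\pi^\star_\tau\|\overline\pi^{(T)})\le2(1-\eta\tau)^T\,\mathrm{KL}(\pi^\star_\tau\|\pi^{(0)}),$$ $$\mathbb E\,\text{QRE-Gap}_\tau(\overline\pi^{(T)})\le4\eta^{-1}(1-\eta\tau)^T\,\mathrm{KL}(\pi^\star_\tau\|\pi^{(0)}).$$ -/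

import Mathlib

open MeasureTheory ProbabilityTheory

/-- A polymatrix game with player set `V` and action sets `S i`: an undirected graph on the players
and payoff matrices `A i j`, with the convention that `A i j = 0` when `{i, j}` is not an edge. -/
structure PolymatrixGame (V : Type*) (S : V → Type*) where
  graph : SimpleGraph V
  A : (i j : V) → Matrix (S i) (S j) ℝ
  A_eq_zero : ∀ i j, ¬ graph.Adj i j → A i j = 0

namespace PolymatrixGame

noncomputable section

/-- Profiles of vectors `(π i)_{i ∈ V}` with `π i ∈ ℝ^{S i}`. -/
abbrev Profile {V : Type*} (S : V → Type*) : Type _ := (i : V) → S i → ℝ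

variable {V : Type*} {S : V → Type*} [Fintype V] [∀ i, Fintype (S i)]

/-- The utility `u_i(s)` of player `i` at the pure strategy profile `s`. -/
def pureUtility (G : PolymatrixGame V S) (i : V) (s : (j : V) → S j) : ℝ :=
  ∑ j, G.A i j (s i) (s j)

/-- The game is zero-sum: the utilities add up to zero at every pure strategy profile. -/
def IsZeroSum (G : PolymatrixGame V S) : Prop :=
  ∀ s : (j : V) → S j, ∑ i, G.pureUtility i s = 0

/-- The payoff vector `A_i π = ∑_j A_{ij} π_j` of player `i`. -/
def payoffVec (G : PolymatrixGame V S) (i : V) (π : Profile S) : S i → ℝ :=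
  fun k => ∑ j, ∑ l, G.A i j k l * π j l

/-- The expected utility `u_i(π) = π_iᵀ A_i π`. -/
def utility (G : PolymatrixGame V S) (i : V) (π : Profile S) : ℝ :=
  ∑ k, π i k * G.payoffVec i π k

/-- The maximal entrywise absolute value `‖A‖_∞` of the payoffs. -/
def payoffNorm (G : PolymatrixGame V S) : ℝ :=
  ⨆ i, ⨆ j, ⨆ k, ⨆ l, |G.A i j k l|

open Classical in
/-- The maximal degree `d_max` of the graph. -/
def dmax (G : PolymatrixGame V S) : ℕ := G.graph.maxDegree

/-- Shannon entropy of a vector. -/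
def entropy {K : Type*} [Fintype K] (p : K → ℝ) : ℝ := ∑ k, Real.negMulLog (p k)

/-- The entropy-regularized utility `u_{i,τ}(π) = u_i(π) + τ H(π_i)`. -/
def regUtility (G : PolymatrixGame V S) (τ : ℝ) (i : V) (π : Profile S) : ℝ :=
  G.utility i π + τ * entropy (π i)

/-- `π` is a quantal response equilibrium at temperature `τ`. -/
def IsQRE (G : PolymatrixGame V S) (τ : ℝ) (π : Profile S) : Prop :=
  ∀ i k, π i k =
    Real.exp (G.payoffVec i π k / τ) / ∑ k', Real.exp (G.payoffVec i π k' / τ)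

open Classical in
/-- `QRE-Gap_τ(π) = max_i [ max_{π_i' ∈ Δ(S_i)} u_{i,τ}(π_i', π_{-i}) - u_{i,τ}(π) ]`. -/
def qreGap (G : PolymatrixGame V S) (τ : ℝ) (π : Profile S) : ℝ :=
  ⨆ i, ((⨆ p : stdSimplex ℝ (S i),
    G.regUtility τ i (Function.update π i (p : S i → ℝ))) - G.regUtility τ i π)

/-- `KL(π ‖ π') = ∑_i KL(π_i ‖ π_i')`, used for `π'` with positive entries. -/
def kl (π π' : Profile S) : ℝ :=
  ∑ i, ∑ k, π i k * Real.log (π i k / π' i k)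

/-- Every player uses the uniform distribution. -/
def uniform : Profile S := fun i _ => 1 / (Fintype.card (S i) : ℝ)

/-- The probability vector proportional to `p(k)^{1-ητ} exp(η v(k))`. -/
def mwStep {K : Type*} [Fintype K] (η τ : ℝ) (p v : K → ℝ) : K → ℝ :=
  fun k => p k ^ (1 - η * τ) * Real.exp (η * v k) /
    ∑ k', p k' ^ (1 - η * τ) * Real.exp (η * v k')

/-- Iterates of single-timescale entropy-regularized OMWU with delays `d i t`: the flag `false`
gives `π^{(t)}`, the flag `true` gives the extrapolated `π̄^{(t)}`. The truncated subtraction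
`t - d i t` is `κ_i^{(t)} = max (t - d i t) 0`. -/
def omwuIter (G : PolymatrixGame V S) (η τ : ℝ) (d : V → ℕ → ℕ) : Bool → ℕ → Profile S
  | _, 0 => uniform
  | false, t + 1 => fun i =>
      mwStep η τ (omwuIter G η τ d false t i)
        (G.payoffVec i (omwuIter G η τ d true (t + 1 - d i (t + 1))))
  | true, t + 1 => fun i =>
      mwStep η τ (omwuIter G η τ d false t i)
        (G.payoffVec i (omwuIter G η τ d true (t - d i t)))
termination_by b t => 2 * t + (if b then 0 else 1)
decreasing_by all_goals simp <;> omega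

/-- The iterate `π^{(t)}`. -/
def omwu (G : PolymatrixGame V S) (η τ : ℝ) (d : V → ℕ → ℕ) (t : ℕ) : Profile S :=
  G.omwuIter η τ d false t

/-- The extrapolated iterate `π̄^{(t)}`. -/
def omwuBar (G : PolymatrixGame V S) (η τ : ℝ) (d : V → ℕ → ℕ) (t : ℕ) : Profile S :=
  G.omwuIter η τ d true t

theorem omwu_zero (G : PolymatrixGame V S) (η τ : ℝ) (d : V → ℕ → ℕ) :
    G.omwu η τ d 0 = uniform := by
  simp [omwu, omwuIter]

theorem omwuBar_zero (G : PolymatrixGame V S) (η τ : ℝ) (d : V → ℕ → ℕ) :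
    G.omwuBar η τ d 0 = uniform := by
  simp [omwuBar, omwuIter]

theorem omwu_succ (G : PolymatrixGame V S) (η τ : ℝ) (d : V → ℕ → ℕ) (t : ℕ) (i : V) :
    G.omwu η τ d (t + 1) i = mwStep η τ (G.omwu η τ d t i)
      (G.payoffVec i (G.omwuBar η τ d (t + 1 - d i (t + 1)))) := by
  simp only [omwu, omwuBar]
  rw [omwuIter]

theorem omwuBar_succ (G : PolymatrixGame V S) (η τ : ℝ) (d : V → ℕ → ℕ) (t : ℕ) (i : V) :
    G.omwuBar η τ d (t + 1) i = mwStep η τ (G.omwu η τ d t i)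
      (G.payoffVec i (G.omwuBar η τ d (t - d i t))) := by
  simp only [omwu, omwuBar]
  rw [omwuIter]

end

end PolymatrixGame

/-- The random delays `γ i t` are mutually independent over all `(i, t)`, integrable, their tail
expectations `𝔼[γ i t ; γ i t ≥ ℓ]` are at most `E ℓ`, and `∑ ζ^ℓ E(ℓ) = L < ∞` with `ζ > 1`. -/
structure RandomDelays {V Ω : Type*} [MeasurableSpace Ω] (μ : Measure Ω)
    (γ : V → ℕ → Ω → ℕ) (E : ℕ → ℝ) (ζ L : ℝ) : Prop where
  measurable : ∀ i t, Measurable (γ i t)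
  indep : iIndepFun (fun (p : V × ℕ) (ω : Ω) => γ p.1 p.2 ω) μ
  integrable : ∀ i t, Integrable (fun ω => (γ i t ω : ℝ)) μ
  tail_le : ∀ i t ℓ, ∫ ω in {ω | ℓ ≤ γ i t ω}, (γ i t ω : ℝ) ∂μ ≤ E ℓ
  one_lt : 1 < ζ
  hasSum : HasSum (fun ℓ : ℕ => ζ ^ ℓ * E ℓ) L

/-!
The iterates are positive probability vectors, and in logarithmic coordinates each update is affine.
Hence the relative entropy from the equilibrium satisfies an exact energy identity
(`relEntropy_mwStep_eq`): it contracts by `ρ = 1 - η τ`, is decreased by the dissipation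
`KL(π̄ₜ₊₁ ‖ πₜ)` and by `η τ KL(π̄ₜ₊₁ ‖ π⋆)`, and is increased by `KL(π̄ₜ₊₁ ‖ πₜ₊₁)` and a cross term.
In a zero-sum polymatrix game the payoff form vanishes on differences of mixed profiles
(`IsZeroSum.sum_payoff_eq_zero`), so the cross term only sees the staleness of the observed payoffs.
Half of `η τ KL(π̄ₜ₊₁ ‖ π⋆)` absorbs it through Pinsker's inequality (`l1_sq_le_relEntropy`), at the
price of a multiple of the squared displacement of `π̄` over the delay (`kl_omwu_succ_le`).
The distance of `πₜ` from `π̄ₜ` is bounded by such displacements too (`symEntropy_succ_le`), and the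
displacements by the dissipation (`totalMove_le`).

The displacement over a delay `m` is at most `m` times the sum of the last `m` squared one-step
moves. Those moves depend on strictly earlier delays (`dependsBefore_iterates`), which are
independent of the present one, so in expectation the delay contributes the tail expectations
`E ℓ`, and the total lag is a convolution of `E` with the expected moves (`integral_totalLag_le`).
Discounting by `ρ⁻ᵗ` and summing over time bounds this convolution by `L`, since `ρ⁻¹ ≤ ζ`; the step
size makes the result a small multiple of the accumulated dissipation (`discounted_bound`).
The surplus controls the extrapolated iterate, and the other half of `η τ KL(π̄ₜ₊₁ ‖ π⋆)` controls the
equilibrium gap, which `qreGap_le` bounds by the relative entropies in both directions.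

Integrability is free: the truncated time stamps `t - γᵢᵗ` take finitely many values, hence so does
every function of finitely many iterates.
-/

namespace PolymatrixGame

noncomputable section

/-! ### Relative entropy of finite distributions -/

/-- The `ℓ¹` norm of a vector with finitely many coordinates; `K → ℝ` itself carries the sup norm. -/
def l1 {K : Type*} [Fintype K] (f : K → ℝ) : ℝ := ∑ k, |f k|

/-- The relative entropy `KL(p ‖ q)` of two vectors, one summand of `kl`. -/
def relEntropy {K : Type*} [Fintype K] (p q : K → ℝ) : ℝ := ∑ k, p k * Real.log (p k / q k)

/-- `p` is a probability vector with positive entries. -/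
structure IsPosDist {K : Type*} [Fintype K] (p : K → ℝ) : Prop where
  pos : ∀ k, 0 < p k
  sum_eq : ∑ k, p k = 1

section Entropy

variable {K : Type*} [Fintype K]

theorem l1_nonneg (f : K → ℝ) : 0 ≤ l1 f := Finset.sum_nonneg fun _ _ => abs_nonneg _

theorem l1_sub_comm (f g : K → ℝ) : l1 (f - g) = l1 (g - f) := by
  simp only [l1, Pi.sub_apply, abs_sub_comm]

theorem l1_sub_le (f g h : K → ℝ) : l1 (f - h) ≤ l1 (f - g) + l1 (g - h) := by
  simp only [l1, ← Finset.sum_add_distrib, Pi.sub_apply]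
  exact Finset.sum_le_sum fun k _ => abs_sub_le _ _ _

/-- The gap between the two sides has derivative `(x - 1)³ / (x² (x + 2)²)`, so its minimum is the
value `0` at `x = 1`. -/
theorem le_log_of_pos {x : ℝ} (hx : 0 < x) :
    (x - 1) * (5 * x + 1) / (2 * x * (x + 2)) ≤ Real.log x := by
  set φ : ℝ → ℝ := fun y => Real.log y - (y - 1) * (5 * y + 1) / (2 * y * (y + 2)) with hφ
  have hder : ∀ y : ℝ, 0 < y → HasDerivAt φ ((y - 1) ^ 3 / (y ^ 2 * (y + 2) ^ 2)) y := by
    intro y hy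
    have h1 := Real.hasDerivAt_log hy.ne'
    have hn : HasDerivAt (fun y : ℝ => (y - 1) * (5 * y + 1))
        (1 * (5 * y + 1) + (y - 1) * (5 * 1)) y :=
      ((hasDerivAt_id y).sub_const 1).mul (((hasDerivAt_id y).const_mul 5).add_const 1)
    have hd : HasDerivAt (fun y : ℝ => 2 * y * (y + 2)) (2 * 1 * (y + 2) + 2 * y * 1) y :=
      ((hasDerivAt_id y).const_mul 2).mul ((hasDerivAt_id y).add_const 2)
    have h2 := h1.sub (hn.div hd (by positivity))
    refine h2.congr_deriv ?_
    have : y + 2 ≠ 0 := by positivity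
    field_simp
    ring
  have h1 : φ 1 = 0 := by simp [hφ]
  suffices h : φ 1 ≤ φ x by
    rw [h1] at h
    simpa [hφ] using h
  rcases le_total 1 x with h | h
  · refine monotoneOn_of_deriv_nonneg (convex_Ici 1)
      (fun y hy => (hder y (by grind)).continuousAt.continuousWithinAt)
      (fun y hy => (hder y ?_).differentiableAt.differentiableWithinAt)
      (fun y hy => ?_) (Set.mem_Ici.2 le_rfl) h h
    · rw [interior_Ici] at hy; exact lt_trans one_pos hy
    · rw [interior_Ici] at hy
      have hy' : (1 : ℝ) < y := hy
      rw [(hder y (by linarith)).deriv]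
      have : 0 ≤ y - 1 := by linarith
      positivity
  · refine antitoneOn_of_deriv_nonpos (convex_Icc x 1)
      (fun y hy => (hder y (lt_of_lt_of_le hx hy.1)).continuousAt.continuousWithinAt)
      (fun y hy => (hder y ?_).differentiableAt.differentiableWithinAt)
      (fun y hy => ?_) (Set.left_mem_Icc.2 h) (Set.right_mem_Icc.2 h) h
    · rw [interior_Icc] at hy; exact hx.trans hy.1
    · rw [interior_Icc] at hy
      rw [(hder y (hx.trans hy.1)).deriv]
      refine div_nonpos_of_nonpos_of_nonneg ?_ (by positivity)
      have : y - 1 ≤ 0 := by linarith [hy.2]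
      exact Odd.pow_nonpos (by decide) this

theorem three_mul_sq_le {x : ℝ} (hx : 0 ≤ x) :
    3 * (x - 1) ^ 2 ≤ (2 * x + 4) * (x * Real.log x - x + 1) := by
  rcases hx.eq_or_lt with rfl | hx
  · norm_num
  have h := mul_le_mul_of_nonneg_left (le_log_of_pos hx)
    (show 0 ≤ 2 * x * (x + 2) by positivity)
  rw [mul_div_cancel₀ _ (by positivity)] at h
  nlinarith

/-- Pinsker's inequality for finite distributions. -/
theorem l1_sq_le_relEntropy {p q : K → ℝ} (hp : ∀ k, 0 ≤ p k) (hp1 : ∑ k, p k = 1)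
    (hq : IsPosDist q) : l1 (p - q) ^ 2 ≤ 2 * relEntropy p q := by
  -- Cauchy-Schwarz for `|p - q| = √(q (2x + 4) / 3) · √(q (x log x - x + 1))`, `x = p / q`.
  have h1 : ∑ k, q k * (2 * (p k / q k) + 4) / 3 = 2 := by
    have : ∀ k, q k * (2 * (p k / q k) + 4) / 3 = (2 / 3) * p k + (4 / 3) * q k := by
      intro k
      have := (hq.pos k).ne'
      field_simp
    simp only [this, Finset.sum_add_distrib, ← Finset.mul_sum, hp1, hq.sum_eq]
    norm_num
  have h2 : ∑ k, q k * (p k / q k * Real.log (p k / q k) - p k / q k + 1) = relEntropy p q := by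
    have : ∀ k, q k * (p k / q k * Real.log (p k / q k) - p k / q k + 1)
        = p k * Real.log (p k / q k) - p k + q k := by
      intro k
      have := (hq.pos k).ne'
      field_simp
    simp only [this, Finset.sum_add_distrib, Finset.sum_sub_distrib, hp1, hq.sum_eq, relEntropy]
    ring
  rw [← h1, ← h2]
  have key : ∀ k, |p k - q k| ^ 2 ≤ (q k * (2 * (p k / q k) + 4) / 3) *
      (q k * (p k / q k * Real.log (p k / q k) - p k / q k + 1)) := by
    intro k
    have hqk := hq.pos k
    have h := three_mul_sq_le (div_nonneg (hp k) hqk.le)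
    have e : |p k - q k| ^ 2 = q k ^ 2 * (p k / q k - 1) ^ 2 := by
      rw [sq_abs]; field_simp
    rw [e]
    nlinarith [mul_le_mul_of_nonneg_left h (sq_nonneg (q k))]
  have hx : ∀ k, 0 ≤ p k / q k := fun k => div_nonneg (hp k) (hq.pos k).le
  refine Finset.sum_sq_le_sum_mul_sum_of_sq_le_mul _ (fun k _ => ?_) (fun k _ => ?_)
    (fun k _ => key k)
  · have := hx k; have := hq.pos k; positivity
  · refine mul_nonneg (hq.pos k).le ?_
    have h := three_mul_sq_le (hx k)
    by_contra hneg
    push Not at hneg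
    nlinarith [hx k, sq_nonneg (p k / q k - 1)]

theorem relEntropy_nonneg {p q : K → ℝ} (hp : ∀ k, 0 ≤ p k) (hp1 : ∑ k, p k = 1)
    (hq : IsPosDist q) : 0 ≤ relEntropy p q := by
  have := l1_sq_le_relEntropy hp hp1 hq
  nlinarith [sq_nonneg (l1 (p - q))]

theorem IsPosDist.nonneg {p : K → ℝ} (hp : IsPosDist p) (k : K) : 0 ≤ p k := (hp.pos k).le

theorem IsPosDist.relEntropy_nonneg {p q : K → ℝ} (hp : IsPosDist p) (hq : IsPosDist q) :
    0 ≤ relEntropy p q :=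
  PolymatrixGame.relEntropy_nonneg hp.nonneg hp.sum_eq hq

theorem IsPosDist.l1_sq_le {p q : K → ℝ} (hp : IsPosDist p) (hq : IsPosDist q) :
    l1 (p - q) ^ 2 ≤ 2 * relEntropy p q :=
  l1_sq_le_relEntropy hp.nonneg hp.sum_eq hq

theorem relEntropy_eq {p q : K → ℝ} (hq : ∀ k, 0 < q k) :
    relEntropy p q = ∑ k, (p k * Real.log (p k) - p k * Real.log (q k)) := by
  refine Finset.sum_congr rfl fun k _ => ?_
  rcases eq_or_ne (p k) 0 with h | h
  · simp [h]
  · rw [Real.log_div h (hq k).ne']; ring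

/-! ### One multiplicative-weights step -/

theorem mwStep_isPosDist [Nonempty K] {η τ : ℝ} {p : K → ℝ} (hp : IsPosDist p) (v : K → ℝ) :
    IsPosDist (mwStep η τ p v) := by
  have h : ∀ k, 0 < p k ^ (1 - η * τ) * Real.exp (η * v k) := fun k =>
    mul_pos (Real.rpow_pos_of_pos (hp.pos k) _) (Real.exp_pos _)
  have hs := Finset.sum_pos (fun k _ => h k) (Finset.univ_nonempty (α := K))
  refine ⟨fun k => div_pos (h k) hs, ?_⟩
  simp only [mwStep]
  rw [← Finset.sum_div, div_self hs.ne']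

theorem exists_log_mwStep [Nonempty K] (η τ : ℝ) {p : K → ℝ} (hp : IsPosDist p) (v : K → ℝ) :
    ∃ c : ℝ, ∀ k, Real.log (mwStep η τ p v k) = (1 - η * τ) * Real.log (p k) + η * v k + c := by
  have h : ∀ k, 0 < p k ^ (1 - η * τ) * Real.exp (η * v k) := fun k =>
    mul_pos (Real.rpow_pos_of_pos (hp.pos k) _) (Real.exp_pos _)
  have hs := Finset.sum_pos (fun k _ => h k) (Finset.univ_nonempty (α := K))
  refine ⟨-Real.log (∑ k', p k' ^ (1 - η * τ) * Real.exp (η * v k')), fun k => ?_⟩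
  rw [mwStep, Real.log_div (h k).ne' hs.ne', Real.log_mul
    (Real.rpow_pos_of_pos (hp.pos k) _).ne' (Real.exp_pos _).ne', Real.log_exp,
    Real.log_rpow (hp.pos k)]
  ring

theorem uniform_isPosDist [Nonempty K] : IsPosDist (fun _ : K => 1 / (Fintype.card K : ℝ)) := by
  refine ⟨fun k => by positivity, ?_⟩
  simp

/-- The one-player energy identity. Here `p` is the current iterate, `q` an arbitrary comparison
distribution (later the extrapolated iterate), and `s` the softmax of `u / τ`. -/
theorem relEntropy_mwStep_eq [Nonempty K] {η τ : ℝ} {s p q : K → ℝ} (hs : IsPosDist s)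
    (hp : IsPosDist p) (hq : IsPosDist q) {u : K → ℝ} {c : ℝ}
    (hu : ∀ k, τ * Real.log (s k) = u k + c) (v : K → ℝ) :
    relEntropy s (mwStep η τ p v) = (1 - η * τ) * relEntropy s p - (1 - η * τ) * relEntropy q p
      - η * τ * relEntropy q s + relEntropy q (mwStep η τ p v)
      + η * ∑ k, (q k - s k) * (v k - u k) := by
  obtain ⟨c', hc'⟩ := exists_log_mwStep η τ hp v
  rw [relEntropy_eq (mwStep_isPosDist hp v).pos, relEntropy_eq hp.pos, relEntropy_eq hp.pos,
    relEntropy_eq hs.pos, relEntropy_eq (mwStep_isPosDist hp v).pos]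
  simp only [hc', Finset.mul_sum]
  rw [← Finset.sum_sub_distrib, ← Finset.sum_sub_distrib, ← Finset.sum_add_distrib,
    ← Finset.sum_add_distrib, ← sub_eq_zero, ← Finset.sum_sub_distrib]
  have hz : ∑ k, (q k - s k) * (c' - η * c) = 0 := by
    rw [← Finset.sum_mul, Finset.sum_sub_distrib, hq.sum_eq, hs.sum_eq]; ring
  rw [← hz]
  refine Finset.sum_congr rfl fun k _ => ?_
  linear_combination (-η * (q k - s k)) * hu k

/-- The symmetrized relative entropy of two steps from the same point is linear in the difference
of the two payoff vectors. -/
theorem relEntropy_mwStep_add [Nonempty K] {η τ : ℝ} {p : K → ℝ} (hp : IsPosDist p)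
    (v w : K → ℝ) :
    relEntropy (mwStep η τ p v) (mwStep η τ p w) + relEntropy (mwStep η τ p w) (mwStep η τ p v)
      = η * ∑ k, (mwStep η τ p v k - mwStep η τ p w k) * (v k - w k) := by
  obtain ⟨c, hc⟩ := exists_log_mwStep η τ hp v
  obtain ⟨c', hc'⟩ := exists_log_mwStep η τ hp w
  have hv := mwStep_isPosDist (η := η) (τ := τ) hp v
  have hw := mwStep_isPosDist (η := η) (τ := τ) hp w
  have hz : ∑ k, (mwStep η τ p v k - mwStep η τ p w k) * (c - c') = 0 := by
    rw [← Finset.sum_mul, Finset.sum_sub_distrib, hv.sum_eq, hw.sum_eq]; ring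
  rw [relEntropy_eq hv.pos, relEntropy_eq hw.pos, ← Finset.sum_add_distrib, Finset.mul_sum,
    ← add_zero (∑ k, η * _), ← hz, ← Finset.sum_add_distrib]
  refine Finset.sum_congr rfl fun k _ => ?_
  rw [hc, hc']
  ring

/-- A step with payoffs `x`-close in the dual norm moves the distribution by at most `O(η² x²)`
in symmetrized relative entropy. -/
theorem relEntropy_mwStep_add_le [Nonempty K] {η τ x : ℝ} {p : K → ℝ} (hp : IsPosDist p)
    (hη : 0 ≤ η) {v w : K → ℝ} (hx : ∀ f : K → ℝ, ∑ k, f k * (v k - w k) ≤ x * l1 f) :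
    relEntropy (mwStep η τ p v) (mwStep η τ p w) + relEntropy (mwStep η τ p w) (mwStep η τ p v)
      ≤ η ^ 2 * x ^ 2 := by
  have hv := mwStep_isPosDist (η := η) (τ := τ) hp v
  have hw := mwStep_isPosDist (η := η) (τ := τ) hp w
  have h1 := hv.l1_sq_le hw
  have h2 := hw.l1_sq_le hv
  rw [l1_sub_comm] at h2
  have h3 := relEntropy_mwStep_add (η := η) (τ := τ) hp v w
  have h4 := mul_le_mul_of_nonneg_left (hx (mwStep η τ p v - mwStep η τ p w)) hη
  simp only [Pi.sub_apply] at h4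
  rw [← h3] at h4
  nlinarith [sq_nonneg (η * x - l1 (mwStep η τ p v - mwStep η τ p w))]

/-- Replacing the extrapolated step `v` by the step `w` costs a factor two in the relative entropy
to any target. -/
theorem relEntropy_mwStep_le_two_mul [Nonempty K] {η τ x : ℝ} {s p : K → ℝ} (hs : IsPosDist s)
    (hp : IsPosDist p) (hη : 0 ≤ η) {v w : K → ℝ}
    (hx : ∀ f : K → ℝ, ∑ k, f k * (v k - w k) ≤ x * l1 f) :
    relEntropy s (mwStep η τ p v) ≤ 2 * relEntropy s (mwStep η τ p w)
      + 3 / 2 * (η ^ 2 * x ^ 2) := by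
  obtain ⟨c, hc⟩ := exists_log_mwStep η τ hp v
  obtain ⟨c', hc'⟩ := exists_log_mwStep η τ hp w
  have hv := mwStep_isPosDist (η := η) (τ := τ) hp v
  have hw := mwStep_isPosDist (η := η) (τ := τ) hp w
  have hz : ∑ k, (s k - mwStep η τ p w k) * (c' - c) = 0 := by
    rw [← Finset.sum_mul, Finset.sum_sub_distrib, hs.sum_eq, hw.sum_eq]; ring
  have hid : relEntropy s (mwStep η τ p v) = relEntropy s (mwStep η τ p w)
      + relEntropy (mwStep η τ p w) (mwStep η τ p v)
      + η * ∑ k, (mwStep η τ p w k - s k) * (v k - w k) := by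
    rw [relEntropy_eq hv.pos, relEntropy_eq hw.pos, relEntropy_eq hv.pos, Finset.mul_sum,
      ← Finset.sum_add_distrib, ← Finset.sum_add_distrib, ← add_zero (∑ k, (_ + _ + _)), ← hz,
      ← Finset.sum_add_distrib]
    refine Finset.sum_congr rfl fun k _ => ?_
    rw [hc, hc']
    ring
  have h1 := relEntropy_mwStep_add_le (τ := τ) hp hη hx
  have h2 := hv.relEntropy_nonneg hw
  have h3 := mul_le_mul_of_nonneg_left (hx (mwStep η τ p w - s)) hη
  have h4 := hs.l1_sq_le hw
  rw [l1_sub_comm] at h4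
  simp only [Pi.sub_apply] at h3
  nlinarith [sq_nonneg (η * x - l1 (mwStep η τ p w - s))]

end Entropy

/-! ### Zero-sum polymatrix games -/

section Game

variable {V : Type*} {S : V → Type*}

theorem A_self (G : PolymatrixGame V S) (i : V) : G.A i i = 0 := G.A_eq_zero i i (by simp)

theorem payoffNorm_nonneg (G : PolymatrixGame V S) : 0 ≤ G.payoffNorm :=
  Real.iSup_nonneg fun _ => Real.iSup_nonneg fun _ => Real.iSup_nonneg fun _ =>
    Real.iSup_nonneg fun _ => abs_nonneg _

variable [Fintype V]

/-- The neighbours of a player, as a finite set. -/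
def nbrs (G : PolymatrixGame V S) (i : V) : Finset V :=
  open Classical in G.graph.neighborFinset i

theorem mem_nbrs {G : PolymatrixGame V S} {i j : V} : j ∈ G.nbrs i ↔ G.graph.Adj i j := by
  classical
  simp [nbrs]

theorem card_nbrs_le (G : PolymatrixGame V S) (i : V) : (G.nbrs i).card ≤ G.dmax := by
  classical
  rw [nbrs, SimpleGraph.card_neighborFinset_eq_degree]
  exact SimpleGraph.degree_le_maxDegree _ _

/-- Each player is a neighbour of at most `dmax` players. -/
theorem sum_nbrs_le (G : PolymatrixGame V S) {f : V → ℝ} (hf : ∀ j, 0 ≤ f j) :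
    ∑ i, ∑ j ∈ G.nbrs i, f j ≤ G.dmax * ∑ j, f j := by
  classical
  have e : ∑ i, ∑ j ∈ G.nbrs i, f j = ∑ j, ∑ i ∈ G.nbrs j, f j :=
    Finset.sum_comm' fun i j => by simp [mem_nbrs, SimpleGraph.adj_comm]
  rw [e, Finset.mul_sum]
  refine Finset.sum_le_sum fun j _ => ?_
  rw [Finset.sum_const, nsmul_eq_mul]
  exact mul_le_mul_of_nonneg_right (by exact_mod_cast G.card_nbrs_le j) (hf j)

/-- The symmetrized payoffs of a zero-sum polymatrix game have vanishing second differences. -/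
theorem IsZeroSum.second_difference {G : PolymatrixGame V S} (hG : G.IsZeroSum)
    (s : (j : V) → S j) {i j : V} (hij : i ≠ j) (k : S i) (l : S j) :
    G.A i j k l + G.A j i l k = (G.A i j k (s j) + G.A j i (s j) k)
      + (G.A i j (s i) l + G.A j i l (s i)) - (G.A i j (s i) (s j) + G.A j i (s j) (s i)) := by
  classical
  set s₁ := Function.update s i k with hs₁
  set s₂ := Function.update s j l with hs₂
  set s₃ := Function.update s₁ j l with hs₃
  have hi1 : s₁ i = k := by simp [hs₁]
  have hj1 : s₁ j = s j := by simp [hs₁, hij.symm]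
  have hi2 : s₂ i = s i := by simp [hs₂, hij]
  have hj2 : s₂ j = l := by simp [hs₂]
  have hi3 : s₃ i = k := by simp [hs₃, hij, hi1]
  have hj3 : s₃ j = l := by simp [hs₃]
  have ho : ∀ a, a ≠ i → a ≠ j → s₁ a = s a ∧ s₂ a = s a ∧ s₃ a = s a := by
    intro a hai haj
    simp [hs₁, hs₂, hs₃, hai, haj]
  -- The second difference of the total utility, one summand per ordered pair of players.
  set F : V → V → ℝ := fun a b => G.A a b (s₃ a) (s₃ b) - G.A a b (s₁ a) (s₁ b)
    - G.A a b (s₂ a) (s₂ b) + G.A a b (s a) (s b) with hF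
  have h0 : ∑ a, ∑ b, F a b = 0 := by
    have e : ∀ s : (j : V) → S j, ∑ a, ∑ b, G.A a b (s a) (s b) = 0 := hG
    simp only [hF, Finset.sum_add_distrib, Finset.sum_sub_distrib, e]
    ring
  have hFo : ∀ a b, a ≠ i → a ≠ j → F a b = 0 ∧ F b a = 0 := by
    intro a b hai haj
    obtain ⟨e1, e2, e3⟩ := ho a hai haj
    simp only [hF, e1, e2, e3]
    rcases eq_or_ne b i with rfl | hbi
    · rw [hi1, hi2, hi3]; constructor <;> ring
    rcases eq_or_ne b j with rfl | hbj
    · rw [hj1, hj2, hj3]; constructor <;> ring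
    obtain ⟨f1, f2, f3⟩ := ho b hbi hbj
    rw [f1, f2, f3]; constructor <;> ring
  have hFd : ∀ a, F a a = 0 := by intro a; simp [hF, A_self]
  have hr : ∀ a b, (∀ c, c ≠ b → F a c = 0) → ∑ c, F a c = F a b := fun a b h =>
    Finset.sum_eq_single b (fun c _ hc => h c hc) (by simp)
  have hri : ∑ c, F i c = F i j := hr i j fun c hc => by
    rcases eq_or_ne c i with rfl | hci
    · exact hFd c
    · exact (hFo c i hci hc).2
  have hrj : ∑ c, F j c = F j i := hr j i fun c hc => by
    rcases eq_or_ne c j with rfl | hcj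
    · exact hFd c
    · exact (hFo c j hc hcj).2
  have hsum : ∑ a, ∑ b, F a b = F i j + F j i := by
    rw [← hri, ← hrj, ← Finset.sum_pair (f := fun a => ∑ b, F a b) hij]
    symm
    refine Finset.sum_subset (Finset.subset_univ _) fun a _ ha => ?_
    simp only [Finset.mem_insert, Finset.mem_singleton, not_or] at ha
    exact Finset.sum_eq_zero fun b _ => (hFo a b ha.1 ha.2).1
  rw [h0] at hsum
  simp only [hF, hi1, hi2, hi3, hj1, hj2, hj3] at hsum
  linarith

variable [∀ i, Fintype (S i)]

theorem abs_le_payoffNorm (G : PolymatrixGame V S) (i j : V) (k : S i) (l : S j) :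
    |G.A i j k l| ≤ G.payoffNorm := by
  unfold payoffNorm
  refine le_ciSup_of_le (Set.finite_range _).bddAbove i ?_
  refine le_ciSup_of_le (Set.finite_range _).bddAbove j ?_
  refine le_ciSup_of_le (Set.finite_range _).bddAbove k ?_
  exact le_ciSup (f := fun l => |G.A i j k l|) (Set.finite_range _).bddAbove l

/-- In a zero-sum game the payoff form vanishes on differences of two mixed profiles: its
symmetrization is a sum of functions of one action each, which a vector of total mass zero
annihilates. -/
theorem IsZeroSum.sum_payoff_eq_zero [∀ i, Nonempty (S i)] {G : PolymatrixGame V S}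
    (hG : G.IsZeroSum) {δ : Profile S} (hδ : ∀ i, ∑ k, δ i k = 0) :
    ∑ i, ∑ k, δ i k * G.payoffVec i δ k = 0 := by
  have s : (j : V) → S j := fun j => Classical.arbitrary _
  set B : V → V → ℝ := fun i j => ∑ k, ∑ l, δ i k * G.A i j k l * δ j l with hB
  have hsum : ∑ i, ∑ k, δ i k * G.payoffVec i δ k = ∑ i, ∑ j, B i j := by
    refine Finset.sum_congr rfl fun i _ => ?_
    simp only [hB, payoffVec, Finset.mul_sum]
    rw [Finset.sum_comm]
    simp only [mul_assoc]
  have hanti : ∀ i j, B i j + B j i = 0 := by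
    intro i j
    rcases eq_or_ne i j with rfl | hij
    · simp [hB, A_self]
    have e : B i j + B j i = ∑ k, ∑ l, δ i k * (G.A i j k l + G.A j i l k) * δ j l := by
      simp only [hB]
      rw [Finset.sum_comm (f := fun k l => δ j k * G.A j i k l * δ i l),
        ← Finset.sum_add_distrib]
      refine Finset.sum_congr rfl fun k _ => ?_
      rw [← Finset.sum_add_distrib]
      exact Finset.sum_congr rfl fun l _ => by ring
    rw [e]
    have hl : ∀ c : ℝ, ∑ l, c * δ j l = 0 := fun c => by rw [← Finset.mul_sum, hδ, mul_zero]
    have hk : ∑ k, ∑ l, δ i k * ((G.A i j (s i) l + G.A j i l (s i))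
        - (G.A i j (s i) (s j) + G.A j i (s j) (s i))) * δ j l = 0 := by
      rw [Finset.sum_comm]
      refine Finset.sum_eq_zero fun l _ => ?_
      rw [← Finset.sum_mul, ← Finset.sum_mul, hδ, zero_mul, zero_mul]
    rw [← hk]
    refine Finset.sum_congr rfl fun k _ => ?_
    have := hl (δ i k * (G.A i j k (s j) + G.A j i (s j) k))
    rw [← add_zero (∑ l, δ i k * (_ - _) * δ j l), ← this, ← Finset.sum_add_distrib]
    refine Finset.sum_congr rfl fun l _ => ?_
    rw [hG.second_difference s hij k l]
    ring
  rw [hsum]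
  have h2 : ∑ i, ∑ j, B i j + ∑ i, ∑ j, B i j = 0 := by
    nth_rewrite 2 [Finset.sum_comm]
    rw [← Finset.sum_add_distrib]
    refine Finset.sum_eq_zero fun i _ => ?_
    rw [← Finset.sum_add_distrib]
    exact Finset.sum_eq_zero fun j _ => hanti i j
  linarith

/-- The total `ℓ¹` distance between the strategies of the neighbours of player `i`. -/
def nbrDist (G : PolymatrixGame V S) (i : V) (σ σ' : Profile S) : ℝ :=
  ∑ j ∈ G.nbrs i, l1 (σ j - σ' j)

theorem nbrDist_sq_le (G : PolymatrixGame V S) (i : V) (σ σ' : Profile S) :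
    G.nbrDist i σ σ' ^ 2 ≤ G.dmax * ∑ j ∈ G.nbrs i, l1 (σ j - σ' j) ^ 2 := by
  refine sq_sum_le_card_mul_sum_sq.trans ?_
  exact mul_le_mul_of_nonneg_right (by exact_mod_cast G.card_nbrs_le i)
    (Finset.sum_nonneg fun _ _ => sq_nonneg _)

theorem nbrDist_nonneg (G : PolymatrixGame V S) (i : V) (σ σ' : Profile S) :
    0 ≤ G.nbrDist i σ σ' := Finset.sum_nonneg fun _ _ => l1_nonneg _

theorem payoffVec_sub (G : PolymatrixGame V S) (i : V) (σ σ' : Profile S) (k : S i) :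
    G.payoffVec i σ k - G.payoffVec i σ' k = G.payoffVec i (fun j => σ j - σ' j) k := by
  simp only [payoffVec, ← Finset.sum_sub_distrib, Pi.sub_apply, mul_sub]

theorem abs_payoffVec_sub_le (G : PolymatrixGame V S) (i : V) (σ σ' : Profile S) (k : S i) :
    |G.payoffVec i σ k - G.payoffVec i σ' k| ≤ G.payoffNorm * G.nbrDist i σ σ' := by
  rw [payoffVec_sub, payoffVec, nbrDist, Finset.mul_sum]
  have e : ∑ j, ∑ l, G.A i j k l * (σ j - σ' j) l
      = ∑ j ∈ G.nbrs i, ∑ l, G.A i j k l * (σ j - σ' j) l := by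
    symm
    refine Finset.sum_subset (Finset.subset_univ _) fun j _ hj => ?_
    rw [G.A_eq_zero i j (fun h => hj (mem_nbrs.2 h))]
    simp
  rw [e]
  refine (Finset.abs_sum_le_sum_abs _ _).trans (Finset.sum_le_sum fun j _ => ?_)
  refine (Finset.abs_sum_le_sum_abs _ _).trans ?_
  rw [l1, Finset.mul_sum]
  refine Finset.sum_le_sum fun l _ => ?_
  rw [abs_mul]
  exact mul_le_mul_of_nonneg_right (G.abs_le_payoffNorm i j k l) (abs_nonneg _)

theorem sum_mul_payoffVec_sub_le (G : PolymatrixGame V S) (i : V) (σ σ' : Profile S)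
    (f : S i → ℝ) : ∑ k, f k * (G.payoffVec i σ k - G.payoffVec i σ' k)
      ≤ G.payoffNorm * G.nbrDist i σ σ' * l1 f := by
  rw [l1, Finset.mul_sum]
  refine Finset.sum_le_sum fun k _ => ?_
  refine (le_abs_self _).trans ?_
  rw [abs_mul, mul_comm]
  exact mul_le_mul_of_nonneg_right (G.abs_payoffVec_sub_le i σ σ' k) (abs_nonneg _)

/-! ### Quantal response equilibria and the equilibrium gap -/

theorem IsQRE.isPosDist [∀ i, Nonempty (S i)] {G : PolymatrixGame V S} {τ : ℝ} {π : Profile S}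
    (h : G.IsQRE τ π) (i : V) : IsPosDist (π i) := by
  have hs : 0 < ∑ k, Real.exp (G.payoffVec i π k / τ) :=
    Finset.sum_pos (fun k _ => Real.exp_pos _) Finset.univ_nonempty
  refine ⟨fun k => ?_, ?_⟩
  · rw [h i k]; exact div_pos (Real.exp_pos _) hs
  · simp only [h i]
    rw [← Finset.sum_div, div_self hs.ne']

theorem IsQRE.exists_log [∀ i, Nonempty (S i)] {G : PolymatrixGame V S} {τ : ℝ} {π : Profile S}
    (h : G.IsQRE τ π) (hτ : 0 < τ) (i : V) :
    ∃ c : ℝ, ∀ k, τ * Real.log (π i k) = G.payoffVec i π k + c := by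
  have hs : 0 < ∑ k, Real.exp (G.payoffVec i π k / τ) :=
    Finset.sum_pos (fun k _ => Real.exp_pos _) Finset.univ_nonempty
  refine ⟨-τ * Real.log (∑ k, Real.exp (G.payoffVec i π k / τ)), fun k => ?_⟩
  rw [h i k, Real.log_div (Real.exp_pos _).ne' hs.ne', Real.log_exp]
  field_simp
  ring

open Classical in
theorem regUtility_update (G : PolymatrixGame V S) (τ : ℝ) (i : V) (π : Profile S) (p : S i → ℝ) :
    G.regUtility τ i (Function.update π i p)
      = ∑ k, p k * G.payoffVec i π k + τ * entropy p := by
  have h : ∀ k, G.payoffVec i (Function.update π i p) k = G.payoffVec i π k := by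
    intro k
    refine Finset.sum_congr rfl fun j _ => ?_
    rcases eq_or_ne j i with rfl | hj
    · simp [A_self]
    · simp [Function.update_of_ne hj]
  simp [regUtility, utility, h]

theorem entropy_eq {K : Type*} [Fintype K] (p : K → ℝ) :
    entropy p = -∑ k, p k * Real.log (p k) := by
  simp [entropy, Real.negMulLog, Finset.sum_neg_distrib]

open Classical in
/-- The gain of one player from a unilateral deviation. -/
theorem regUtility_update_sub_le [∀ i, Nonempty (S i)] {G : PolymatrixGame V S} {τ : ℝ}
    (hτ : 0 < τ) {s π : Profile S} (hs : G.IsQRE τ s) (hπ : ∀ i, IsPosDist (π i)) (i : V)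
    {p : S i → ℝ} (hp : p ∈ stdSimplex ℝ (S i)) :
    G.regUtility τ i (Function.update π i p) - G.regUtility τ i π
      ≤ G.payoffNorm ^ 2 * G.nbrDist i π s ^ 2 / (2 * τ)
        - ∑ k, (π i k - s i k) * (G.payoffVec i π k - G.payoffVec i s k)
        + τ * relEntropy (π i) (s i) := by
  obtain ⟨c, hc⟩ := hs.exists_log hτ i
  have hsi := hs.isPosDist i
  have e0 := G.regUtility_update τ i π (π i)
  rw [Function.update_eq_self] at e0
  have hz : ∑ k, (π i k - p k) * c = 0 := by
    rw [← Finset.sum_mul, Finset.sum_sub_distrib, hp.2, (hπ i).sum_eq]; ring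
  -- With `A_i s = τ log s_i + const`, the payoffs at `s` combine with the entropies into relative
  -- entropies to `s_i`.
  have hid : G.regUtility τ i (Function.update π i p) - G.regUtility τ i π
      = ∑ k, (p k - s i k) * (G.payoffVec i π k - G.payoffVec i s k)
        - ∑ k, (π i k - s i k) * (G.payoffVec i π k - G.payoffVec i s k)
        + τ * relEntropy (π i) (s i) - τ * relEntropy p (s i) := by
    rw [regUtility_update, e0, relEntropy_eq hsi.pos, relEntropy_eq hsi.pos, entropy_eq,
      entropy_eq, ← sub_eq_zero, ← hz]
    simp only [Finset.mul_sum, mul_neg, ← Finset.sum_neg_distrib, ← Finset.sum_add_distrib,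
      ← Finset.sum_sub_distrib]
    refine Finset.sum_congr rfl fun k _ => ?_
    linear_combination (π i k - p k) * hc k
  have h1 := G.sum_mul_payoffVec_sub_le i π s (p - s i)
  simp only [Pi.sub_apply] at h1
  have h2 := l1_sq_le_relEntropy hp.1 hp.2 hsi
  have h3 : G.payoffNorm * G.nbrDist i π s * l1 (p - s i)
      ≤ G.payoffNorm ^ 2 * G.nbrDist i π s ^ 2 / (2 * τ) + τ / 2 * l1 (p - s i) ^ 2 := by
    rw [div_add' _ _ _ (by positivity), le_div_iff₀ (by positivity)]
    nlinarith [sq_nonneg (G.payoffNorm * G.nbrDist i π s - τ * l1 (p - s i))]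
  nlinarith

/-- The sum of squared neighbour distances to a positive profile is controlled by `kl`. -/
theorem sum_nbrDist_sq_le (G : PolymatrixGame V S) {s π : Profile S} (hs : ∀ i, IsPosDist (s i))
    (hπ : ∀ i, IsPosDist (π i)) :
    ∑ i, G.nbrDist i π s ^ 2 ≤ 2 * (G.dmax : ℝ) ^ 2 * kl s π := by
  calc ∑ i, G.nbrDist i π s ^ 2
      ≤ ∑ i, G.dmax * ∑ j ∈ G.nbrs i, l1 (π j - s j) ^ 2 :=
        Finset.sum_le_sum fun i _ => G.nbrDist_sq_le i π s
    _ = G.dmax * ∑ i, ∑ j ∈ G.nbrs i, l1 (π j - s j) ^ 2 := by rw [Finset.mul_sum]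
    _ ≤ G.dmax * (G.dmax * ∑ j, l1 (π j - s j) ^ 2) := by
        gcongr; exact G.sum_nbrs_le fun j => sq_nonneg _
    _ ≤ G.dmax * (G.dmax * ∑ j, 2 * relEntropy (s j) (π j)) := by
        gcongr with j
        rw [l1_sub_comm]
        exact (hs j).l1_sq_le (hπ j)
    _ = 2 * (G.dmax : ℝ) ^ 2 * kl s π := by
        rw [← Finset.mul_sum]
        simp only [kl, relEntropy]
        ring

/-- The equilibrium gap is controlled by the two relative entropies to the equilibrium. The
maximum over players is bounded by the sum, in which the payoff form drops out by the zero-sum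
property. -/
theorem qreGap_le [∀ i, Nonempty (S i)] {G : PolymatrixGame V S} (hG : G.IsZeroSum) {τ : ℝ}
    (hτ : 0 < τ) {s π : Profile S} (hs : G.IsQRE τ s) (hπ : ∀ i, IsPosDist (π i)) :
    G.qreGap τ π ≤ τ * kl π s + (G.dmax : ℝ) ^ 2 * G.payoffNorm ^ 2 / τ * kl s π := by
  classical
  set c : V → ℝ := fun i => G.payoffNorm ^ 2 * G.nbrDist i π s ^ 2 / (2 * τ)
        - ∑ k, (π i k - s i k) * (G.payoffVec i π k - G.payoffVec i s k)
        + τ * relEntropy (π i) (s i) with hc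
  have hle : ∀ i, ∀ p ∈ stdSimplex ℝ (S i),
      G.regUtility τ i (Function.update π i p) - G.regUtility τ i π ≤ c i :=
    fun i p hp => regUtility_update_sub_le hτ hs hπ i hp
  have hc0 : ∀ i, 0 ≤ c i := fun i => by
    have := hle i (π i) ⟨(hπ i).nonneg, (hπ i).sum_eq⟩
    rwa [Function.update_eq_self, sub_self] at this
  have h1 : G.qreGap τ π ≤ ∑ i, c i := by
    refine Real.iSup_le (fun i => ?_) (Finset.sum_nonneg fun i _ => hc0 i)
    refine le_trans ?_ (Finset.single_le_sum (fun i _ => hc0 i) (Finset.mem_univ i))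
    have : Nonempty (stdSimplex ℝ (S i)) := ⟨⟨π i, (hπ i).nonneg, (hπ i).sum_eq⟩⟩
    rw [sub_le_iff_le_add]
    exact ciSup_le fun p => by linarith [hle i p p.2]
  have hz : ∑ i, ∑ k, (π i k - s i k) * (G.payoffVec i π k - G.payoffVec i s k) = 0 := by
    simp only [payoffVec_sub]
    refine hG.sum_payoff_eq_zero (δ := fun i => π i - s i) fun i => ?_
    simp [Finset.sum_sub_distrib, (hπ i).sum_eq, (hs.isPosDist i).sum_eq]
  have h2 : ∑ i, c i
      = G.payoffNorm ^ 2 / (2 * τ) * ∑ i, G.nbrDist i π s ^ 2 + τ * kl π s := by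
    simp only [hc, Finset.sum_add_distrib, Finset.sum_sub_distrib, hz, sub_zero, Finset.mul_sum]
    congr 1
    · exact Finset.sum_congr rfl fun i _ => by ring
    · simp only [kl, relEntropy, Finset.mul_sum]
  have h3 := mul_le_mul_of_nonneg_left (G.sum_nbrDist_sq_le hs.isPosDist hπ)
    (show 0 ≤ G.payoffNorm ^ 2 / (2 * τ) by positivity)
  have h4 : G.payoffNorm ^ 2 / (2 * τ) * (2 * (G.dmax : ℝ) ^ 2 * kl s π)
      = (G.dmax : ℝ) ^ 2 * G.payoffNorm ^ 2 / τ * kl s π := by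
    field_simp
  linarith

end Game

/-! ### Energy estimates along one realization of the delays -/

/-- The squared length of a delayed displacement, with the range of summation extended to a
deterministic one so that the delay enters only through the coefficients. -/
theorem l1_sub_delay_sq_le {K : Type*} [Fintype K] (X : ℕ → K → ℝ) (t m : ℕ) :
    l1 (X (t - m) - X t) ^ 2 ≤ ∑ l ∈ Finset.range t,
      (if l + 1 ≤ m then (m : ℝ) else 0) * l1 (X (t - 1 - l + 1) - X (t - 1 - l)) ^ 2 := by
  have tele : ∀ n ≤ t, l1 (X (t - n) - X t)
      ≤ ∑ l ∈ Finset.range n, l1 (X (t - 1 - l + 1) - X (t - 1 - l)) := by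
    intro n
    induction n with
    | zero => intro _; simp [l1]
    | succ n ih =>
      intro hn
      have h1 := l1_sub_le (X (t - (n + 1))) (X (t - n)) (X t)
      rw [l1_sub_comm (X (t - (n + 1))) (X (t - n))] at h1
      rw [Finset.sum_range_succ, show t - 1 - n + 1 = t - n by omega,
        show t - 1 - n = t - (n + 1) by omega]
      linarith [ih (by omega)]
  have hmin : t - m = t - min m t := by omega
  rw [hmin]
  have hcs := sq_sum_le_card_mul_sum_sq (s := Finset.range (min m t))
    (f := fun l => l1 (X (t - 1 - l + 1) - X (t - 1 - l)))
  have h0 := pow_le_pow_left₀ (l1_nonneg _) (tele (min m t) (min_le_right _ _)) 2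
  refine (h0.trans hcs).trans ?_
  rw [Finset.card_range]
  calc ((min m t : ℕ) : ℝ) * ∑ l ∈ Finset.range (min m t),
        l1 (X (t - 1 - l + 1) - X (t - 1 - l)) ^ 2
      ≤ (m : ℝ) * ∑ l ∈ Finset.range (min m t), l1 (X (t - 1 - l + 1) - X (t - 1 - l)) ^ 2 := by
        refine mul_le_mul_of_nonneg_right ?_ (Finset.sum_nonneg fun _ _ => sq_nonneg _)
        exact_mod_cast min_le_left m t
    _ = ∑ l ∈ Finset.range (min m t),
        (if l + 1 ≤ m then (m : ℝ) else 0) * l1 (X (t - 1 - l + 1) - X (t - 1 - l)) ^ 2 := by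
        rw [Finset.mul_sum]
        refine Finset.sum_congr rfl fun l hl => ?_
        rw [if_pos]
        have := Finset.mem_range.1 hl
        omega
    _ ≤ _ := by
        refine Finset.sum_le_sum_of_subset_of_nonneg (fun l hl => ?_) fun l _ _ => ?_
        · have := Finset.mem_range.1 hl
          exact Finset.mem_range.2 (by omega)
        · split_ifs <;> positivity

section Dynamics

variable {V : Type*} {S : V → Type*} [Fintype V] [∀ i, Fintype (S i)]

/-- The squared `ℓ¹` displacement of player `j` between the extrapolated iterates `t` and
`t + 1`. -/
def move (G : PolymatrixGame V S) (η τ : ℝ) (d : V → ℕ → ℕ) (t : ℕ) (j : V) : ℝ :=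
  l1 (G.omwuBar η τ d (t + 1) j - G.omwuBar η τ d t j) ^ 2

/-- An upper bound for the squared displacement of player `j` between the extrapolated iterate `t`
and the older one which player `i` observes at time `t`. -/
def lag (G : PolymatrixGame V S) (η τ : ℝ) (d : V → ℕ → ℕ) (t : ℕ) (i j : V) : ℝ :=
  ∑ l ∈ Finset.range t,
    (if l + 1 ≤ d i t then (d i t : ℝ) else 0) * G.move η τ d (t - 1 - l) j

/-- The total displacement of all players. -/
def totalMove (G : PolymatrixGame V S) (η τ : ℝ) (d : V → ℕ → ℕ) (t : ℕ) : ℝ :=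
  ∑ j, G.move η τ d t j

/-- The sum of `lag` over all ordered pairs of neighbours. -/
def totalLag (G : PolymatrixGame V S) (η τ : ℝ) (d : V → ℕ → ℕ) (t : ℕ) : ℝ :=
  ∑ i, ∑ j ∈ G.nbrs i, G.lag η τ d t i j

/-- The symmetrized relative entropy between the two iterates at time `t`. -/
def symEntropy (G : PolymatrixGame V S) (η τ : ℝ) (d : V → ℕ → ℕ) (t : ℕ) : ℝ :=
  kl (G.omwuBar η τ d t) (G.omwu η τ d t) + kl (G.omwu η τ d t) (G.omwuBar η τ d t)

/-- A bound for the total squared distance between the two observations that drive `omwuBar` and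
`omwu` from time `t` to time `t + 1`. -/
def drift (G : PolymatrixGame V S) (η τ : ℝ) (d : V → ℕ → ℕ) (t : ℕ) : ℝ :=
  3 * G.dmax * (G.totalLag η τ d t + G.dmax * G.totalMove η τ d t + G.totalLag η τ d (t + 1))

theorem kl_eq_sum (π π' : Profile S) : kl π π' = ∑ i, relEntropy (π i) (π' i) := rfl

theorem kl_nonneg {π π' : Profile S} (h : ∀ i, IsPosDist (π i)) (h' : ∀ i, IsPosDist (π' i)) :
    0 ≤ kl π π' := Finset.sum_nonneg fun i _ => (h i).relEntropy_nonneg (h' i)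

theorem move_nonneg (G : PolymatrixGame V S) (η τ : ℝ) (d : V → ℕ → ℕ) (t : ℕ) (j : V) :
    0 ≤ G.move η τ d t j := sq_nonneg _

theorem sum_nbrDist_delay_sq_le (G : PolymatrixGame V S) (η τ : ℝ) (d : V → ℕ → ℕ) (t : ℕ) :
    ∑ i, G.nbrDist i (G.omwuBar η τ d (t - d i t)) (G.omwuBar η τ d t) ^ 2
      ≤ G.dmax * G.totalLag η τ d t := by
  rw [totalLag, Finset.mul_sum]
  refine Finset.sum_le_sum fun i _ => (G.nbrDist_sq_le i _ _).trans ?_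
  gcongr with j
  exact l1_sub_delay_sq_le (fun t => G.omwuBar η τ d t j) t (d i t)

theorem sum_nbrDist_succ_sq_le (G : PolymatrixGame V S) (η τ : ℝ) (d : V → ℕ → ℕ) (t : ℕ) :
    ∑ i, G.nbrDist i (G.omwuBar η τ d (t + 1)) (G.omwuBar η τ d t) ^ 2
      ≤ G.dmax * (G.dmax * G.totalMove η τ d t) := by
  refine (Finset.sum_le_sum fun i _ => G.nbrDist_sq_le i _ _).trans ?_
  rw [← Finset.mul_sum]
  gcongr
  exact G.sum_nbrs_le fun j => sq_nonneg _

theorem sum_nbrDist_observed_sq_le (G : PolymatrixGame V S) (η τ : ℝ) (d : V → ℕ → ℕ) (t : ℕ) :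
    ∑ i, G.nbrDist i (G.omwuBar η τ d (t - d i t)) (G.omwuBar η τ d (t + 1 - d i (t + 1))) ^ 2
      ≤ G.drift η τ d t := by
  have h1 := G.sum_nbrDist_delay_sq_le η τ d t
  have h2 := G.sum_nbrDist_succ_sq_le η τ d t
  have h3 := G.sum_nbrDist_delay_sq_le η τ d (t + 1)
  have key : ∀ i, G.nbrDist i (G.omwuBar η τ d (t - d i t))
      (G.omwuBar η τ d (t + 1 - d i (t + 1))) ^ 2
      ≤ 3 * (G.nbrDist i (G.omwuBar η τ d (t - d i t)) (G.omwuBar η τ d t) ^ 2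
        + G.nbrDist i (G.omwuBar η τ d (t + 1)) (G.omwuBar η τ d t) ^ 2
        + G.nbrDist i (G.omwuBar η τ d (t + 1 - d i (t + 1))) (G.omwuBar η τ d (t + 1)) ^ 2) := by
    intro i
    set w := G.omwuBar η τ d
    set x := G.nbrDist i (w (t - d i t)) (w t)
    set y := G.nbrDist i (w (t + 1)) (w t)
    set z := G.nbrDist i (w (t + 1 - d i (t + 1))) (w (t + 1))
    have h : G.nbrDist i (w (t - d i t)) (w (t + 1 - d i (t + 1))) ≤ x + y + z := by
      simp only [nbrDist, x, y, z, ← Finset.sum_add_distrib]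
      refine Finset.sum_le_sum fun j _ => ?_
      have e1 := l1_sub_le (w (t - d i t) j) (w t j) (w (t + 1 - d i (t + 1)) j)
      have e2 := l1_sub_le (w t j) (w (t + 1) j) (w (t + 1 - d i (t + 1)) j)
      rw [l1_sub_comm (w t j) (w (t + 1) j),
        l1_sub_comm (w (t + 1) j) (w (t + 1 - d i (t + 1)) j)] at e2
      linarith
    have h' := pow_le_pow_left₀ (G.nbrDist_nonneg i _ _) h 2
    nlinarith [sq_nonneg (x - y), sq_nonneg (y - z), sq_nonneg (x - z)]
  refine (Finset.sum_le_sum fun i _ => key i).trans ?_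
  rw [← Finset.mul_sum, Finset.sum_add_distrib, Finset.sum_add_distrib, drift]
  nlinarith

variable [∀ i, Nonempty (S i)]

theorem omwu_isPosDist (G : PolymatrixGame V S) (η τ : ℝ) (d : V → ℕ → ℕ) (t : ℕ) (i : V) :
    IsPosDist (G.omwu η τ d t i) := by
  induction t with
  | zero => rw [omwu_zero]; exact uniform_isPosDist
  | succ t ih => rw [omwu_succ]; exact mwStep_isPosDist ih _

theorem omwuBar_isPosDist (G : PolymatrixGame V S) (η τ : ℝ) (d : V → ℕ → ℕ) (t : ℕ) (i : V) :
    IsPosDist (G.omwuBar η τ d t i) := by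
  cases t with
  | zero => rw [omwuBar_zero]; exact uniform_isPosDist
  | succ t => rw [omwuBar_succ]; exact mwStep_isPosDist (G.omwu_isPosDist η τ d t i) _

theorem symEntropy_zero (G : PolymatrixGame V S) (η τ : ℝ) (d : V → ℕ → ℕ) :
    G.symEntropy η τ d 0 = 0 := by
  have h : kl (S := S) uniform uniform = 0 := by
    refine Finset.sum_eq_zero fun i _ => Finset.sum_eq_zero fun k _ => ?_
    have : uniform (S := S) i k ≠ 0 := (uniform_isPosDist.pos k).ne'
    rw [div_self this, Real.log_one, mul_zero]
  rw [symEntropy, omwu_zero, omwuBar_zero, h, add_zero]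

/-- The two iterates at the same time are close: they are steps from the same point, driven by
nearby payoff observations. -/
theorem symEntropy_succ_le (G : PolymatrixGame V S) {η : ℝ} (hη : 0 ≤ η) (τ : ℝ)
    (d : V → ℕ → ℕ) (t : ℕ) :
    G.symEntropy η τ d (t + 1) ≤ η ^ 2 * G.payoffNorm ^ 2 * G.drift η τ d t := by
  refine le_trans ?_ (mul_le_mul_of_nonneg_left (G.sum_nbrDist_observed_sq_le η τ d t)
    (by positivity))
  rw [symEntropy, kl_eq_sum, kl_eq_sum, ← Finset.sum_add_distrib, Finset.mul_sum]
  refine Finset.sum_le_sum fun i _ => ?_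
  rw [omwu_succ, omwuBar_succ, mul_assoc, ← mul_pow]
  exact relEntropy_mwStep_add_le (G.omwu_isPosDist η τ d t i) hη
    (G.sum_mul_payoffVec_sub_le i _ _)

theorem kl_omwuBar_succ_le (G : PolymatrixGame V S) {η : ℝ} (hη : 0 ≤ η) (τ : ℝ)
    (d : V → ℕ → ℕ) (t : ℕ) {s : Profile S} (hs : ∀ i, IsPosDist (s i)) :
    kl s (G.omwuBar η τ d (t + 1)) ≤ 2 * kl s (G.omwu η τ d (t + 1))
      + 3 / 2 * (η ^ 2 * G.payoffNorm ^ 2 * G.drift η τ d t) := by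
  have h := mul_le_mul_of_nonneg_left (G.sum_nbrDist_observed_sq_le η τ d t)
    (show 0 ≤ 3 / 2 * (η ^ 2 * G.payoffNorm ^ 2) by positivity)
  refine le_trans ?_ (le_of_le_of_eq (add_le_add le_rfl h) (by rw [mul_assoc (3 / 2 : ℝ)]))
  rw [kl_eq_sum, kl_eq_sum, Finset.mul_sum, Finset.mul_sum,
    ← Finset.sum_add_distrib]
  refine Finset.sum_le_sum fun i _ => ?_
  rw [omwu_succ, omwuBar_succ, mul_assoc (3 / 2 : ℝ), mul_assoc (η ^ 2), ← mul_pow]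
  exact relEntropy_mwStep_le_two_mul (hs i) (G.omwu_isPosDist η τ d t i) hη
    (G.sum_mul_payoffVec_sub_le i _ _)

theorem totalMove_le (G : PolymatrixGame V S) (η τ : ℝ) (d : V → ℕ → ℕ) (t : ℕ) :
    G.totalMove η τ d t ≤ 4 * kl (G.omwuBar η τ d (t + 1)) (G.omwu η τ d t)
      + 2 * G.symEntropy η τ d t := by
  rw [totalMove, symEntropy, kl_eq_sum, kl_eq_sum, kl_eq_sum, ← Finset.sum_add_distrib,
    Finset.mul_sum, Finset.mul_sum, ← Finset.sum_add_distrib]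
  refine Finset.sum_le_sum fun i _ => ?_
  have p := G.omwu_isPosDist η τ d t i
  have q := G.omwuBar_isPosDist η τ d t i
  have r := G.omwuBar_isPosDist η τ d (t + 1) i
  have h1 := r.l1_sq_le p
  have h2 := p.l1_sq_le q
  have h3 := q.l1_sq_le p
  rw [l1_sub_comm] at h3
  have h4 := pow_le_pow_left₀ (l1_nonneg _) (l1_sub_le (G.omwuBar η τ d (t + 1) i)
    (G.omwu η τ d t i) (G.omwuBar η τ d t i)) 2
  rw [move]
  nlinarith [sq_nonneg (l1 (G.omwuBar η τ d (t + 1) i - G.omwu η τ d t i)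
    - l1 (G.omwu η τ d t i - G.omwuBar η τ d t i))]

/-- The energy inequality. By the zero-sum property only the staleness of the payoff observation
contributes to the cross term; it is absorbed by half of the entropy to the equilibrium. -/
theorem kl_omwu_succ_le {G : PolymatrixGame V S} (hG : G.IsZeroSum) {η τ : ℝ} (hη : 0 ≤ η)
    (hτ : 0 < τ) (d : V → ℕ → ℕ) (t : ℕ) {s : Profile S} (hs : G.IsQRE τ s) :
    kl s (G.omwu η τ d (t + 1)) ≤ (1 - η * τ) * kl s (G.omwu η τ d t)
      - (1 - η * τ) * kl (G.omwuBar η τ d (t + 1)) (G.omwu η τ d t)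
      - η * τ / 2 * kl (G.omwuBar η τ d (t + 1)) s
      + G.symEntropy η τ d (t + 1)
      + η / τ * G.payoffNorm ^ 2 * (G.dmax * G.totalLag η τ d (t + 1)) := by
  set q := G.omwuBar η τ d (t + 1) with hqdef
  set p := G.omwu η τ d t with hpdef
  have hq : ∀ i, IsPosDist (q i) := G.omwuBar_isPosDist η τ d (t + 1)
  have hp : ∀ i, IsPosDist (p i) := G.omwu_isPosDist η τ d t
  set w : V → Profile S := fun i => G.omwuBar η τ d (t + 1 - d i (t + 1)) with hw
  have hz : ∑ i, ∑ k, (q i k - s i k) * (G.payoffVec i q k - G.payoffVec i s k) = 0 := by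
    simp only [payoffVec_sub]
    refine hG.sum_payoff_eq_zero (δ := fun i => q i - s i) fun i => ?_
    simp [Finset.sum_sub_distrib, (hq i).sum_eq, (hs.isPosDist i).sum_eq]
  have hplayer : ∀ i, relEntropy (s i) (G.omwu η τ d (t + 1) i)
      ≤ (1 - η * τ) * relEntropy (s i) (p i) - (1 - η * τ) * relEntropy (q i) (p i)
        - η * τ / 2 * relEntropy (q i) (s i) + relEntropy (q i) (G.omwu η τ d (t + 1) i)
        + η / τ * G.payoffNorm ^ 2 * G.nbrDist i (w i) q ^ 2
        + η * ∑ k, (q i k - s i k) * (G.payoffVec i q k - G.payoffVec i s k) := by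
    intro i
    obtain ⟨c, hc⟩ := hs.exists_log hτ i
    have h := relEntropy_mwStep_eq (η := η) (hs.isPosDist i) (hp i) (hq i) hc
      (G.payoffVec i (w i))
    rw [omwu_succ]
    rw [h]
    have h1 := G.sum_mul_payoffVec_sub_le i (w i) q (q i - s i)
    simp only [Pi.sub_apply] at h1
    have h2 := (hq i).l1_sq_le (hs.isPosDist i)
    have e : ∑ k, (q i k - s i k) * (G.payoffVec i (w i) k - G.payoffVec i s k)
        = ∑ k, (q i k - s i k) * (G.payoffVec i (w i) k - G.payoffVec i q k)
          + ∑ k, (q i k - s i k) * (G.payoffVec i q k - G.payoffVec i s k) := by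
      rw [← Finset.sum_add_distrib]
      exact Finset.sum_congr rfl fun k _ => by ring
    have h3 : G.payoffNorm * G.nbrDist i (w i) q * l1 (q i - s i)
        ≤ G.payoffNorm ^ 2 * G.nbrDist i (w i) q ^ 2 / τ + τ / 4 * l1 (q i - s i) ^ 2 := by
      rw [div_add' _ _ _ hτ.ne', le_div_iff₀ hτ]
      nlinarith [sq_nonneg (2 * (G.payoffNorm * G.nbrDist i (w i) q) - τ * l1 (q i - s i))]
    have h4 : ∑ k, (q i k - s i k) * (G.payoffVec i (w i) k - G.payoffVec i q k)
        ≤ G.payoffNorm ^ 2 * G.nbrDist i (w i) q ^ 2 / τ + τ / 2 * relEntropy (q i) (s i) := by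
      nlinarith
    have h5 := mul_le_mul_of_nonneg_left h4 hη
    rw [e]
    have e2 : η * (G.payoffNorm ^ 2 * G.nbrDist i (w i) q ^ 2 / τ
        + τ / 2 * relEntropy (q i) (s i)) = η / τ * G.payoffNorm ^ 2 * G.nbrDist i (w i) q ^ 2
        + η * τ / 2 * relEntropy (q i) (s i) := by ring
    rw [e2] at h5
    linarith
  have hsum := Finset.sum_le_sum fun i (_ : i ∈ Finset.univ) => hplayer i
  simp only [Finset.sum_add_distrib, Finset.sum_sub_distrib, ← Finset.mul_sum, hz] at hsum
  have hlag := mul_le_mul_of_nonneg_left (G.sum_nbrDist_delay_sq_le η τ d (t + 1))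
    (show 0 ≤ η / τ * G.payoffNorm ^ 2 by positivity)
  have hJ : kl q (G.omwu η τ d (t + 1)) ≤ G.symEntropy η τ d (t + 1) := by
    rw [symEntropy]
    linarith [kl_nonneg (G.omwu_isPosDist η τ d (t + 1)) hq]
  simp only [← kl_eq_sum] at hsum
  linarith

end Dynamics

/-! ### Dependence of the iterates on the delays -/

section Dependence

variable {V : Type*} {S : V → Type*}

/-- `Φ` depends only on the time stamps `s - d i s` observed before time `n`. -/
def DependsBefore {α : Type*} (n : ℕ) (Φ : (V → ℕ → ℕ) → α) : Prop :=
  ∀ d d' : V → ℕ → ℕ, (∀ i, ∀ s < n, s - d i s = s - d' i s) → Φ d = Φ d'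

theorem DependsBefore.mono {α : Type*} {m n : ℕ} (h : m ≤ n) {Φ : (V → ℕ → ℕ) → α}
    (hΦ : DependsBefore m Φ) : DependsBefore n Φ :=
  fun d d' e => hΦ d d' fun i s hs => e i s (hs.trans_le h)

theorem DependsBefore.comp {α β : Type*} {n : ℕ} {Φ : (V → ℕ → ℕ) → α}
    (hΦ : DependsBefore n Φ) (f : α → β) : DependsBefore n fun d => f (Φ d) :=
  fun d d' e => congrArg f (hΦ d d' e)

theorem DependsBefore.comp₂ {α β δ : Type*} {n : ℕ} {Φ : (V → ℕ → ℕ) → α}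
    {Ψ : (V → ℕ → ℕ) → β} (hΦ : DependsBefore n Φ) (hΨ : DependsBefore n Ψ) (f : α → β → δ) :
    DependsBefore n fun d => f (Φ d) (Ψ d) :=
  fun d d' e => by simp only [hΦ d d' e, hΨ d d' e]

/-- The extrapolated iterate `t` is determined before time `t`, the iterate `t` one step later. -/
theorem dependsBefore_iterates [Fintype V] [∀ i, Fintype (S i)] (G : PolymatrixGame V S)
    (η τ : ℝ) (t : ℕ) : DependsBefore t (fun d => G.omwuBar η τ d t) ∧
      DependsBefore (t + 1) (fun d => G.omwu η τ d t) := by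
  induction t using Nat.strong_induction_on with
  | _ t ih =>
    cases t with
    | zero => exact ⟨fun d d' _ => by simp [omwuBar_zero], fun d d' _ => by simp [omwu_zero]⟩
    | succ t =>
      have hbar : DependsBefore (t + 1) (fun d => G.omwuBar η τ d (t + 1)) := by
        intro d d' e
        funext i
        have h1 := (ih t (by omega)).2 d d' e
        have h2 := (ih (t - d' i t) (by omega)).1 d d' fun i s hs => e i s (by omega)
        simp only at h1 h2
        simp only [omwuBar_succ, h1, e i t (by omega), h2]
      refine ⟨hbar, fun d d' e => ?_⟩
      funext i
      have h1 := (ih t (by omega)).2 d d' fun i s hs => e i s (by omega)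
      have h2 : G.omwuBar η τ d (t + 1 - d' i (t + 1))
          = G.omwuBar η τ d' (t + 1 - d' i (t + 1)) := by
        rcases (Nat.sub_le (t + 1) (d' i (t + 1))).lt_or_eq with h | h
        · exact (ih _ h).1 d d' fun i s hs => e i s (by omega)
        · rw [h]
          exact hbar d d' fun i s hs => e i s (by omega)
      simp only at h1
      simp only [omwu_succ, h1, e i (t + 1) (by omega), h2]

theorem dependsBefore_omwuBar [Fintype V] [∀ i, Fintype (S i)] (G : PolymatrixGame V S)
    (η τ : ℝ) (t : ℕ) : DependsBefore t (fun d => G.omwuBar η τ d t) :=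
  (G.dependsBefore_iterates η τ t).1

theorem dependsBefore_omwu [Fintype V] [∀ i, Fintype (S i)] (G : PolymatrixGame V S)
    (η τ : ℝ) (t : ℕ) : DependsBefore (t + 1) (fun d => G.omwu η τ d t) :=
  (G.dependsBefore_iterates η τ t).2

theorem dependsBefore_move [Fintype V] [∀ i, Fintype (S i)] (G : PolymatrixGame V S)
    (η τ : ℝ) (t : ℕ) (j : V) : DependsBefore (t + 1) (fun d => G.move η τ d t j) :=
  (G.dependsBefore_omwuBar η τ (t + 1)).comp₂
    ((G.dependsBefore_omwuBar η τ t).mono t.le_succ) fun π π' => l1 (π j - π' j) ^ 2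

/-- Only finitely many time stamps are possible, so such an observable takes finitely many
values. -/
theorem DependsBefore.exists_bound [Finite V] {n : ℕ} {Φ : (V → ℕ → ℕ) → ℝ}
    (hΦ : DependsBefore n Φ) : ∃ C : ℝ, ∀ d, ‖Φ d‖ ≤ C := by
  set g : (V → Fin n → Fin n) → ℝ := fun h =>
    ‖Φ fun i s => if hs : s < n then (h i ⟨s, hs⟩ : ℕ) else 0‖ with hg
  obtain ⟨C, hC⟩ := (Set.finite_range g).bddAbove
  refine ⟨C, fun d => ?_⟩
  have h := hC ⟨fun i s => ⟨min (d i s) s, lt_of_le_of_lt (min_le_right _ _) s.2⟩, rfl⟩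
  have e : Φ d = Φ fun i s => if s < n then min (d i s) s else 0 :=
    hΦ _ _ fun i s hs => by rw [if_pos hs]; omega
  rw [e]
  simpa [hg] using h

end Dependence

/-! ### Random delays -/

section Random

theorem indicator_tail_eq {α : Type*} (γ : α → ℕ) (l : ℕ) :
    (fun ω => if l ≤ γ ω then (γ ω : ℝ) else 0)
      = Set.indicator {ω | l ≤ γ ω} fun ω => (γ ω : ℝ) := by
  funext ω
  simp [Set.indicator_apply]

variable {V Ω : Type*} [MeasurableSpace Ω] {μ : Measure Ω} {γ : V → ℕ → Ω → ℕ} {E : ℕ → ℝ}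
  {ζ L : ℝ}

theorem _root_.RandomDelays.nonneg_E [Nonempty V] (hγ : RandomDelays μ γ E ζ L) (l : ℕ) :
    0 ≤ E l :=
  (integral_nonneg fun _ => by positivity).trans (hγ.tail_le (Classical.arbitrary V) 0 l)

theorem measurableSet_tail (hγ : RandomDelays μ γ E ζ L) (i : V) (n l : ℕ) :
    MeasurableSet {ω | l ≤ γ i n ω} :=
  measurableSet_le measurable_const (hγ.measurable i n)

theorem integrable_tail (hγ : RandomDelays μ γ E ζ L) (i : V) (n l : ℕ) :
    Integrable (fun ω => if l ≤ γ i n ω then (γ i n ω : ℝ) else 0) μ := by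
  rw [indicator_tail_eq]
  exact (hγ.integrable i n).indicator (measurableSet_tail hγ i n l)

theorem integral_tail_le (hγ : RandomDelays μ γ E ζ L) (i : V) (n l : ℕ) :
    ∫ ω, (if l ≤ γ i n ω then (γ i n ω : ℝ) else 0) ∂μ ≤ E l := by
  rw [indicator_tail_eq, integral_indicator (measurableSet_tail hγ i n l)]
  exact hγ.tail_le i n l

/-- An observable of the delays before time `n` is a function of finitely many delays. -/
theorem DependsBefore.exists_factor [Fintype V] {n : ℕ} {Φ : (V → ℕ → ℕ) → ℝ}
    (hΦ : DependsBefore n Φ) :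
    ∃ g : ((Finset.univ ×ˢ Finset.range n : Finset (V × ℕ)) → ℕ) → ℝ, Measurable g ∧
      ∀ d, Φ d = g fun p => d p.1.1 p.1.2 := by
  classical
  refine ⟨fun f => Φ fun i s => if h : (i, s) ∈ (Finset.univ ×ˢ Finset.range n : Finset (V × ℕ))
    then f ⟨(i, s), h⟩ else 0, measurable_of_countable _, fun d => hΦ _ _ fun i s hs => ?_⟩
  simp [hs]

variable [Fintype V]

theorem DependsBefore.measurable (hγ : RandomDelays μ γ E ζ L) {n : ℕ} {Φ : (V → ℕ → ℕ) → ℝ}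
    (hΦ : DependsBefore n Φ) : Measurable fun ω => Φ fun i s => γ i s ω := by
  obtain ⟨g, hg, e⟩ := hΦ.exists_factor
  simp only [e]
  exact hg.comp (measurable_pi_lambda _ fun p => hγ.measurable _ _)

theorem DependsBefore.integrable [IsProbabilityMeasure μ] (hγ : RandomDelays μ γ E ζ L) {n : ℕ}
    {Φ : (V → ℕ → ℕ) → ℝ} (hΦ : DependsBefore n Φ) :
    Integrable (fun ω => Φ fun i s => γ i s ω) μ := by
  obtain ⟨C, hC⟩ := hΦ.exists_bound
  exact Integrable.of_bound (hΦ.measurable hγ).aestronglyMeasurable C (ae_of_all _ fun ω => hC _)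

/-- The delay at time `n` is independent of the past. -/
theorem DependsBefore.indepFun (hγ : RandomDelays μ γ E ζ L) {n : ℕ}
    {Φ : (V → ℕ → ℕ) → ℝ} (hΦ : DependsBefore n Φ) (i : V) :
    IndepFun (γ i n) (fun ω => Φ fun i s => γ i s ω) μ := by
  classical
  obtain ⟨g, hg, e⟩ := hΦ.exists_factor
  simp only [e]
  have h := hγ.indep.indepFun_finset {(i, n)} (Finset.univ ×ˢ Finset.range n) (by simp)
    fun p => hγ.measurable _ _
  exact h.comp (φ := fun f => f ⟨(i, n), Finset.mem_singleton_self _⟩)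
    (measurable_of_countable _) hg

theorem integrable_tail_mul [IsProbabilityMeasure μ] (hγ : RandomDelays μ γ E ζ L) {n : ℕ}
    {Φ : (V → ℕ → ℕ) → ℝ} (hΦ : DependsBefore n Φ) (i : V) (l : ℕ) :
    Integrable (fun ω => (if l ≤ γ i n ω then (γ i n ω : ℝ) else 0) *
      Φ fun i s => γ i s ω) μ := by
  have h := (hΦ.indepFun hγ i).comp (φ := fun m : ℕ => if l ≤ m then (m : ℝ) else 0)
    Measurable.of_discrete measurable_id
  exact h.integrable_mul (integrable_tail hγ i n l) (hΦ.integrable hγ)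

theorem integral_tail_mul_le [IsProbabilityMeasure μ] (hγ : RandomDelays μ γ E ζ L) {n : ℕ}
    {Φ : (V → ℕ → ℕ) → ℝ} (hΦ : DependsBefore n Φ) (h0 : ∀ d, 0 ≤ Φ d) (i : V) (l : ℕ) :
    ∫ ω, (if l ≤ γ i n ω then (γ i n ω : ℝ) else 0) * Φ (fun i s => γ i s ω) ∂μ
      ≤ E l * ∫ ω, Φ (fun i s => γ i s ω) ∂μ := by
  have h := (hΦ.indepFun hγ i).comp (φ := fun m : ℕ => if l ≤ m then (m : ℝ) else 0)
    Measurable.of_discrete measurable_id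
  have e := h.integral_fun_mul_eq_mul_integral (integrable_tail hγ i n l).aestronglyMeasurable
    (hΦ.integrable hγ).aestronglyMeasurable
  simp only [Function.comp_apply, id] at e
  rw [e]
  exact mul_le_mul_of_nonneg_right (integral_tail_le hγ i n l) (integral_nonneg fun ω => h0 _)

variable {S : V → Type*} [∀ i, Fintype (S i)]

theorem integrable_move [IsProbabilityMeasure μ] (hγ : RandomDelays μ γ E ζ L)
    (G : PolymatrixGame V S) (η τ : ℝ) (t : ℕ) (j : V) :
    Integrable (fun ω => G.move η τ (fun i s => γ i s ω) t j) μ :=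
  (G.dependsBefore_move η τ t j).integrable hγ

theorem integrable_totalMove [IsProbabilityMeasure μ] (hγ : RandomDelays μ γ E ζ L)
    (G : PolymatrixGame V S) (η τ : ℝ) (t : ℕ) :
    Integrable (fun ω => G.totalMove η τ (fun i s => γ i s ω) t) μ :=
  integrable_finsetSum _ fun j _ => integrable_move hγ G η τ t j

theorem dependsBefore_move_sub (G : PolymatrixGame V S) (η τ : ℝ) {t l : ℕ}
    (hl : l ∈ Finset.range t) (j : V) :
    DependsBefore t (fun d => G.move η τ d (t - 1 - l) j) :=
  (G.dependsBefore_move η τ (t - 1 - l) j).mono (by have := Finset.mem_range.1 hl; omega)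

theorem integrable_lag [IsProbabilityMeasure μ] (hγ : RandomDelays μ γ E ζ L)
    (G : PolymatrixGame V S) (η τ : ℝ) (t : ℕ) (i j : V) :
    Integrable (fun ω => G.lag η τ (fun i s => γ i s ω) t i j) μ :=
  integrable_finsetSum _ fun _ hl =>
    integrable_tail_mul hγ (G.dependsBefore_move_sub η τ hl j) i _

theorem integrable_totalLag [IsProbabilityMeasure μ] (hγ : RandomDelays μ γ E ζ L)
    (G : PolymatrixGame V S) (η τ : ℝ) (t : ℕ) :
    Integrable (fun ω => G.totalLag η τ (fun i s => γ i s ω) t) μ :=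
  integrable_finsetSum _ fun i _ => integrable_finsetSum _ fun j _ =>
    integrable_lag hγ G η τ t i j

theorem integral_lag_le [IsProbabilityMeasure μ] (hγ : RandomDelays μ γ E ζ L)
    (G : PolymatrixGame V S) (η τ : ℝ) (t : ℕ) (i j : V) :
    ∫ ω, G.lag η τ (fun i s => γ i s ω) t i j ∂μ
      ≤ ∑ l ∈ Finset.range t,
        E (l + 1) * ∫ ω, G.move η τ (fun i s => γ i s ω) (t - 1 - l) j ∂μ := by
  simp only [lag]
  rw [integral_finsetSum _ fun l hl =>
    integrable_tail_mul hγ (G.dependsBefore_move_sub η τ hl j) i _]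
  exact Finset.sum_le_sum fun l hl => integral_tail_mul_le hγ (G.dependsBefore_move_sub η τ hl j)
    (fun d => G.move_nonneg η τ d _ j) i _

/-- The expected total lag is a convolution of the tail bounds with the expected moves. -/
theorem integral_totalLag_le [Nonempty V] [IsProbabilityMeasure μ] (hγ : RandomDelays μ γ E ζ L)
    (G : PolymatrixGame V S) (η τ : ℝ) (t : ℕ) :
    ∫ ω, G.totalLag η τ (fun i s => γ i s ω) t ∂μ
      ≤ G.dmax * ∑ l ∈ Finset.range t,
        E (l + 1) * ∫ ω, G.totalMove η τ (fun i s => γ i s ω) (t - 1 - l) ∂μ := by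
  have e : ∑ l ∈ Finset.range t,
      E (l + 1) * ∫ ω, G.totalMove η τ (fun i s => γ i s ω) (t - 1 - l) ∂μ
      = ∑ j, ∑ l ∈ Finset.range t,
        E (l + 1) * ∫ ω, G.move η τ (fun i s => γ i s ω) (t - 1 - l) j ∂μ := by
    rw [Finset.sum_comm]
    refine Finset.sum_congr rfl fun l _ => ?_
    simp only [totalMove]
    rw [integral_finsetSum _ fun j _ => integrable_move hγ G η τ _ j, Finset.mul_sum]
  rw [e]
  refine le_trans ?_ (G.sum_nbrs_le fun j => Finset.sum_nonneg fun l _ =>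
    mul_nonneg (hγ.nonneg_E _) (integral_nonneg fun ω => G.move_nonneg η τ _ _ j))
  simp only [totalLag]
  rw [integral_finsetSum _ fun i _ => integrable_finsetSum _ fun j _ =>
    integrable_lag hγ G η τ t i j]
  refine Finset.sum_le_sum fun i _ => ?_
  rw [integral_finsetSum _ fun j _ => integrable_lag hγ G η τ t i j]
  exact Finset.sum_le_sum fun j _ => integral_lag_le hγ G η τ t i j

end Random

/-! ### Discounted summation -/

theorem sum_shift_le {y : ℕ → ℝ} (hy : ∀ s, 0 ≤ y s) (l n : ℕ) :
    ∑ t ∈ Finset.range (n + 1), (if l < t then y (t - 1 - l) else 0)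
      ≤ ∑ s ∈ Finset.range n, y s := by
  have h : ∑ t ∈ Finset.range (n + 1), (if l < t then y (t - 1 - l) else 0)
      = ∑ s ∈ Finset.range (n - l), y s := by
    induction n with
    | zero => simp
    | succ n ih =>
      rw [Finset.sum_range_succ, ih]
      by_cases h : l < n + 1
      · rw [if_pos h, show n + 1 - l = n - l + 1 by omega, Finset.sum_range_succ,
          show n + 1 - 1 - l = n - l by omega]
      · rw [if_neg h, add_zero, show n - l = 0 by omega, show n + 1 - l = 0 by omega]
  rw [h]
  exact Finset.sum_le_sum_of_subset_of_nonneg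
    (Finset.range_subset_range.2 (Nat.sub_le _ _)) fun _ _ _ => hy _

theorem sum_convolution_le {e y : ℕ → ℝ} (he : ∀ l, 0 ≤ e l) (hy : ∀ s, 0 ≤ y s) {C : ℝ} {n : ℕ}
    (hC : ∑ l ∈ Finset.range n, e l ≤ C) :
    ∑ t ∈ Finset.range (n + 1), ∑ l ∈ Finset.range t, e l * y (t - 1 - l)
      ≤ C * ∑ s ∈ Finset.range n, y s := by
  have h1 : ∀ t ∈ Finset.range (n + 1), ∑ l ∈ Finset.range t, e l * y (t - 1 - l)
      = ∑ l ∈ Finset.range n, e l * (if l < t then y (t - 1 - l) else 0) := by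
    intro t ht
    have ht' := Finset.mem_range.1 ht
    have hs : Finset.range t ⊆ Finset.range n := Finset.range_subset_range.2 (by omega)
    rw [← Finset.sum_subset hs fun l _ hl => by
      rw [if_neg (fun h => hl (Finset.mem_range.2 h)), mul_zero]]
    exact Finset.sum_congr rfl fun l hl => by rw [if_pos (Finset.mem_range.1 hl)]
  rw [Finset.sum_congr rfl h1, Finset.sum_comm]
  simp only [← Finset.mul_sum]
  calc ∑ l ∈ Finset.range n, e l * ∑ t ∈ Finset.range (n + 1), (if l < t then y (t - 1 - l) else 0)
      ≤ ∑ l ∈ Finset.range n, e l * ∑ s ∈ Finset.range n, y s :=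
        Finset.sum_le_sum fun l _ => mul_le_mul_of_nonneg_left (sum_shift_le hy l n) (he l)
    _ ≤ _ := by
        rw [← Finset.sum_mul]
        exact mul_le_mul_of_nonneg_right hC (Finset.sum_nonneg fun _ _ => hy _)

/-- The Lyapunov argument on expectations. Here `a` is the entropy to the equilibrium, `b` the
dissipation, `k` the entropy from the equilibrium, `x` the movement, `J` the symmetrized entropy
and `Y` its drift bound; `M` is the convolution of the tail bounds `E` with `x`. Discounting by
`ρ⁻ᵗ` turns the convolution into multiplication by at most `L`, because `ρ⁻¹ ≤ ζ`, and the
resulting multiple of the movement is less than the accumulated dissipation. -/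
theorem discounted_bound {a b k x J Y M E : ℕ → ℝ} {ρ ζ L c₁ c₂ : ℝ} (hρ : 23 / 24 ≤ ρ)
    (hρζ : 1 ≤ ζ * ρ) (hE : ∀ l, 0 ≤ E l) (hL : HasSum (fun l => ζ ^ l * E l) L)
    (hc₁ : 0 ≤ c₁) (hc₁' : c₁ * (L + 1) ≤ 1 / 192) (hc₂ : 0 ≤ c₂) (hc₂' : c₂ * (L + 1) ≤ 1 / 24)
    (hk : ∀ t, 0 ≤ k t) (hx : ∀ t, 0 ≤ x t) (hY : ∀ t, 0 ≤ Y t)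
    (hM : ∀ t, M t = ∑ l ∈ Finset.range t, E (l + 1) * x (t - 1 - l))
    (hxJ : ∀ t, x t ≤ 4 * b t + 2 * J t) (hJ0 : J 0 = 0) (hJ : ∀ t, J (t + 1) ≤ Y t)
    (hYM : ∀ t, Y t ≤ c₁ * (M t + x t + M (t + 1)))
    (hstep : ∀ t, a (t + 1) ≤ ρ * a t - ρ * b t - k (t + 1) + J (t + 1) + c₂ * M (t + 1))
    (n : ℕ) : a (n + 1) + k (n + 1) + 3 / 4 * Y n ≤ ρ ^ (n + 1) * a 0 := by
  have hρ0 : 0 < ρ := by linarith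
  obtain ⟨r, hr⟩ : ∃ r, r = ρ⁻¹ := ⟨_, rfl⟩
  have hr0 : 0 < r := hr ▸ inv_pos.2 hρ0
  have hrρ : r * ρ = 1 := by rw [hr]; exact inv_mul_cancel₀ hρ0.ne'
  have hrζ : r ≤ ζ := by nlinarith
  have hr' : r ≤ 24 / 23 := by nlinarith
  have hζ0 : 0 ≤ ζ := hr0.le.trans hrζ
  have hL0 : 0 ≤ L := hL.nonneg fun l => mul_nonneg (pow_nonneg hζ0 l) (hE l)
  have hEr : ∀ n, ∑ l ∈ Finset.range n, r ^ (l + 1) * E (l + 1) ≤ L := by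
    intro n
    calc ∑ l ∈ Finset.range n, r ^ (l + 1) * E (l + 1)
        ≤ ∑ l ∈ Finset.range n, ζ ^ (l + 1) * E (l + 1) := by
          gcongr with l
          exact hE _
      _ ≤ ∑ l ∈ Finset.range (n + 1), ζ ^ l * E l := by
          rw [Finset.sum_range_succ']
          have := hE 0
          simp [this]
      _ ≤ L := sum_le_hasSum _ (fun l _ => mul_nonneg (pow_nonneg hζ0 l) (hE l)) hL
  -- Discounted totals of the movement, the dissipation, the drift bounds and the convolution.
  set X := fun n => ∑ t ∈ Finset.range n, r ^ t * x t with hX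
  set B := fun n => ∑ t ∈ Finset.range n, r ^ t * b t with hB
  set Z := fun n => ∑ t ∈ Finset.range n, r ^ (t + 1) * Y t with hZ
  set W := fun n => ∑ t ∈ Finset.range n, r ^ (t + 1) * M (t + 1) with hW
  have hX0 : ∀ n, 0 ≤ X n := fun n => Finset.sum_nonneg fun t _ =>
    mul_nonneg (pow_nonneg hr0.le t) (hx t)
  have hM0 : ∀ t, 0 ≤ M t := fun t => by
    rw [hM]; exact Finset.sum_nonneg fun l _ => mul_nonneg (hE _) (hx _)
  have hWX : ∀ n, W n ≤ L * X n := by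
    intro n
    have h := sum_convolution_le (fun l => mul_nonneg (pow_nonneg hr0.le (l + 1)) (hE (l + 1)))
      (fun s => mul_nonneg (pow_nonneg hr0.le s) (hx s)) (hEr n)
    rw [Finset.sum_range_succ'] at h
    refine le_trans (le_of_eq ?_) h
    rw [Finset.range_zero, Finset.sum_empty, add_zero]
    refine Finset.sum_congr rfl fun t _ => ?_
    rw [hM, Finset.mul_sum]
    refine Finset.sum_congr rfl fun l hl => ?_
    have hl' := Finset.mem_range.1 hl
    have e : r ^ (t + 1) = r ^ (l + 1) * r ^ (t + 1 - 1 - l) := by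
      rw [← pow_add]; congr 1; omega
    rw [e]; ring
  have hM00 : M 0 = 0 := by rw [hM]; simp
  have hMW : ∀ n, ∑ t ∈ Finset.range n, r ^ t * M t ≤ W n := by
    intro n
    have h1 := Finset.sum_range_succ (fun t => r ^ t * M t) n
    rw [Finset.sum_range_succ', hM00, mul_zero, add_zero] at h1
    have := mul_nonneg (pow_nonneg hr0.le n) (hM0 n)
    simp only [hW]
    linarith
  -- `c₁ · 24/23 · 2 (L + 1) ≤ 1/92`, with `r ≤ 24/23`.
  have hZX : ∀ n, Z n ≤ 1 / 92 * X n := by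
    intro n
    have h1 : Z n ≤ c₁ * (r * ∑ t ∈ Finset.range n, r ^ t * M t + r * X n + W n) := by
      simp only [hZ, hX, hW, Finset.mul_sum, ← Finset.sum_add_distrib]
      refine Finset.sum_le_sum fun t _ => ?_
      have := mul_le_mul_of_nonneg_left (hYM t) (pow_nonneg hr0.le (t + 1))
      rw [pow_succ] at this ⊢
      linarith
    have h2 : r * ∑ t ∈ Finset.range n, r ^ t * M t + r * X n + W n
        ≤ 24 / 23 * (L * X n) + 24 / 23 * X n + L * X n := by
      have h3 := (hMW n).trans (hWX n)
      have h4 : 0 ≤ L * X n := mul_nonneg hL0 (hX0 n)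
      have h5 : r * ∑ t ∈ Finset.range n, r ^ t * M t ≤ 24 / 23 * (L * X n) := by
        refine (mul_le_mul_of_nonneg_left h3 hr0.le).trans (mul_le_mul_of_nonneg_right hr' h4)
      have h6 := mul_le_mul_of_nonneg_right hr' (hX0 n)
      linarith [hWX n]
    have h3 := h1.trans (mul_le_mul_of_nonneg_left h2 hc₁)
    have h4 := mul_le_mul_of_nonneg_right hc₁' (hX0 n)
    have h5 : 0 ≤ c₁ * X n := mul_nonneg hc₁ (hX0 n)
    have h6 : 0 ≤ c₁ * (L * X n) := mul_nonneg hc₁ (mul_nonneg hL0 (hX0 n))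
    nlinarith
  have hJZ : ∀ n, ∑ t ∈ Finset.range n, r ^ t * J t ≤ Z n := by
    intro n
    cases n with
    | zero => simp [hZ]
    | succ n =>
      rw [Finset.sum_range_succ', hJ0, mul_zero, add_zero]
      simp only [hZ]
      rw [Finset.sum_range_succ _ n]
      have h1 : ∑ t ∈ Finset.range n, r ^ (t + 1) * J (t + 1)
          ≤ ∑ t ∈ Finset.range n, r ^ (t + 1) * Y t :=
        Finset.sum_le_sum fun t _ => mul_le_mul_of_nonneg_left (hJ t) (pow_nonneg hr0.le _)
      have h2 := mul_nonneg (pow_nonneg hr0.le (n + 1)) (hY n)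
      linarith
  have hXB : ∀ n, X n ≤ 4 * B n + 2 * Z n := by
    intro n
    have h : X n ≤ 4 * B n + 2 * ∑ t ∈ Finset.range n, r ^ t * J t := by
      simp only [hX, hB, Finset.mul_sum, ← Finset.sum_add_distrib]
      refine Finset.sum_le_sum fun t _ => ?_
      have := mul_le_mul_of_nonneg_left (hxJ t) (pow_nonneg hr0.le t)
      linarith
    linarith [hJZ n]
  have hrec : ∀ n, r ^ n * a n ≤ a 0 - B n + Z n + c₂ * W n := by
    intro n
    induction n with
    | zero => simp [hB, hZ, hW]
    | succ n ih =>
      have h1 := mul_le_mul_of_nonneg_left (hstep n) (pow_nonneg hr0.le (n + 1))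
      have h2 := mul_nonneg (pow_nonneg hr0.le (n + 1)) (hk (n + 1))
      have h3 := mul_le_mul_of_nonneg_left (hJ n) (pow_nonneg hr0.le (n + 1))
      have e : ∀ y, r ^ (n + 1) * (ρ * y) = r ^ n * y := fun y => by
        rw [pow_succ]; linear_combination (r ^ n * y) * hrρ
      simp only [hB, hZ, hW, Finset.sum_range_succ] at ih ⊢
      rw [mul_add, mul_add, mul_sub, mul_sub, e, e] at h1
      nlinarith
  -- By `hXB` and `hZX`, `X ≤ (184/45) B`, and `7/4 · 1/92 + 1/24 < 45/184`: the dissipation pays for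
  -- the drift bounds, with three quarters of the last one to spare, and for the convolution.
  have hlast : r ^ (n + 1) * (a (n + 1) + k (n + 1) + 3 / 4 * Y n) ≤ a 0 := by
    have h1 := mul_le_mul_of_nonneg_left (hstep n) (pow_nonneg hr0.le (n + 1))
    have h3 := mul_le_mul_of_nonneg_left (hJ n) (pow_nonneg hr0.le (n + 1))
    have e : ∀ y, r ^ (n + 1) * (ρ * y) = r ^ n * y := fun y => by
      rw [pow_succ]; linear_combination (r ^ n * y) * hrρ
    have h4 := hrec n
    have h5 : r ^ (n + 1) * Y n ≤ Z (n + 1) := by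
      simp only [hZ]
      exact Finset.single_le_sum (f := fun t => r ^ (t + 1) * Y t)
        (fun t _ => mul_nonneg (pow_nonneg hr0.le _) (hY t)) (Finset.self_mem_range_succ n)
    have h6 := hZX (n + 1)
    have h7 := hXB (n + 1)
    have h8 : c₂ * W (n + 1) ≤ 1 / 24 * X (n + 1) := by
      have g1 := mul_le_mul_of_nonneg_left (hWX (n + 1)) hc₂
      have g2 := mul_le_mul_of_nonneg_right hc₂' (hX0 (n + 1))
      have g3 := mul_nonneg hc₂ (hX0 (n + 1))
      nlinarith
    have hB' : B (n + 1) = B n + r ^ n * b n := Finset.sum_range_succ _ _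
    have hZ' : Z (n + 1) = Z n + r ^ (n + 1) * Y n := Finset.sum_range_succ _ _
    have hW' : W (n + 1) = W n + r ^ (n + 1) * M (n + 1) := Finset.sum_range_succ _ _
    rw [mul_add, mul_add, mul_sub, mul_sub, e, e] at h1
    have h9 : r ^ (n + 1) * (a (n + 1) + k (n + 1))
        ≤ a 0 - B (n + 1) + Z (n + 1) + c₂ * W (n + 1) := by
      rw [hB', hZ', hW']
      linarith
    have h10 := hX0 (n + 1)
    linarith
  have e : ρ ^ (n + 1) * r ^ (n + 1) = 1 := by rw [← mul_pow, mul_comm, hrρ, one_pow]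
  calc a (n + 1) + k (n + 1) + 3 / 4 * Y n
      = ρ ^ (n + 1) * (r ^ (n + 1) * (a (n + 1) + k (n + 1) + 3 / 4 * Y n)) := by
        rw [← mul_assoc, e, one_mul]
    _ ≤ ρ ^ (n + 1) * a 0 := mul_le_mul_of_nonneg_left hlast (pow_nonneg hρ0.le _)

/-! ### Expected estimates -/

section Expectation

variable {V Ω : Type*} [Fintype V] {S : V → Type*} [∀ i, Fintype (S i)] [MeasurableSpace Ω]
  {μ : Measure Ω} [IsProbabilityMeasure μ] {γ : V → ℕ → Ω → ℕ} {E : ℕ → ℝ} {ζ L : ℝ}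

theorem integrable_omwu (hγ : RandomDelays μ γ E ζ L) (G : PolymatrixGame V S) (η τ : ℝ) (t : ℕ)
    (f : Profile S → ℝ) : Integrable (fun ω => f (G.omwu η τ (fun i s => γ i s ω) t)) μ :=
  ((G.dependsBefore_omwu η τ t).comp f).integrable hγ

theorem integrable_omwuBar (hγ : RandomDelays μ γ E ζ L) (G : PolymatrixGame V S) (η τ : ℝ)
    (t : ℕ) (f : Profile S → ℝ) :
    Integrable (fun ω => f (G.omwuBar η τ (fun i s => γ i s ω) t)) μ :=
  ((G.dependsBefore_omwuBar η τ t).comp f).integrable hγ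

theorem integrable_kl_omwuBar_succ_omwu (hγ : RandomDelays μ γ E ζ L) (G : PolymatrixGame V S)
    (η τ : ℝ) (t : ℕ) : Integrable (fun ω => kl (G.omwuBar η τ (fun i s => γ i s ω) (t + 1))
      (G.omwu η τ (fun i s => γ i s ω) t)) μ :=
  ((G.dependsBefore_omwuBar η τ (t + 1)).comp₂ (G.dependsBefore_omwu η τ t) kl).integrable hγ

theorem integrable_symEntropy (hγ : RandomDelays μ γ E ζ L) (G : PolymatrixGame V S)
    (η τ : ℝ) (t : ℕ) : Integrable (fun ω => G.symEntropy η τ (fun i s => γ i s ω) t) μ :=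
  (((G.dependsBefore_omwuBar η τ t).mono t.le_succ).comp₂ (G.dependsBefore_omwu η τ t)
    fun π π' => kl π π' + kl π' π).integrable hγ

theorem integrable_drift (hγ : RandomDelays μ γ E ζ L) (G : PolymatrixGame V S)
    (η τ : ℝ) (t : ℕ) : Integrable (fun ω => G.drift η τ (fun i s => γ i s ω) t) μ :=
  (((integrable_totalLag hγ G η τ t).add ((integrable_totalMove hγ G η τ t).const_mul _)).add
    (integrable_totalLag hγ G η τ (t + 1))).const_mul _

theorem integral_drift_eq (hγ : RandomDelays μ γ E ζ L) (G : PolymatrixGame V S)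
    (η τ : ℝ) (t : ℕ) : ∫ ω, G.drift η τ (fun i s => γ i s ω) t ∂μ
      = 3 * G.dmax * (∫ ω, G.totalLag η τ (fun i s => γ i s ω) t ∂μ
        + G.dmax * ∫ ω, G.totalMove η τ (fun i s => γ i s ω) t ∂μ
        + ∫ ω, G.totalLag η τ (fun i s => γ i s ω) (t + 1) ∂μ) := by
  simp only [drift]
  rw [integral_const_mul, integral_add, integral_add, integral_const_mul]
  · exact integrable_totalLag hγ G η τ t
  · exact (integrable_totalMove hγ G η τ t).const_mul _
  · exact (integrable_totalLag hγ G η τ t).add ((integrable_totalMove hγ G η τ t).const_mul _)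
  · exact integrable_totalLag hγ G η τ (t + 1)

variable [∀ i, Nonempty (S i)]

/-- The energy inequality in expectation. -/
theorem integral_kl_omwu_succ_le (hγ : RandomDelays μ γ E ζ L) {G : PolymatrixGame V S}
    (hG : G.IsZeroSum) {η τ : ℝ} (hη : 0 ≤ η) (hτ : 0 < τ) {s : Profile S} (hs : G.IsQRE τ s)
    (t : ℕ) :
    ∫ ω, kl s (G.omwu η τ (fun i s => γ i s ω) (t + 1)) ∂μ
      ≤ (1 - η * τ) * ∫ ω, kl s (G.omwu η τ (fun i s => γ i s ω) t) ∂μ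
        - (1 - η * τ) * ∫ ω, kl (G.omwuBar η τ (fun i s => γ i s ω) (t + 1))
            (G.omwu η τ (fun i s => γ i s ω) t) ∂μ
        - η * τ / 2 * ∫ ω, kl (G.omwuBar η τ (fun i s => γ i s ω) (t + 1)) s ∂μ
        + ∫ ω, G.symEntropy η τ (fun i s => γ i s ω) (t + 1) ∂μ
        + η / τ * G.payoffNorm ^ 2 *
          (G.dmax * ∫ ω, G.totalLag η τ (fun i s => γ i s ω) (t + 1) ∂μ) := by
  have i1 := (integrable_omwu hγ G η τ t (kl s)).const_mul (1 - η * τ)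
  have i2 := (integrable_kl_omwuBar_succ_omwu hγ G η τ t).const_mul (1 - η * τ)
  have i3 := (integrable_omwuBar hγ G η τ (t + 1) fun π => kl π s).const_mul (η * τ / 2)
  have i4 := integrable_symEntropy hγ G η τ (t + 1)
  have i5 := ((integrable_totalLag hγ G η τ (t + 1)).const_mul (G.dmax : ℝ)).const_mul
    (η / τ * G.payoffNorm ^ 2)
  have h := integral_mono (integrable_omwu hγ G η τ (t + 1) (kl s))
    ((((i1.sub i2).sub i3).add i4).add i5)
    fun ω => kl_omwu_succ_le hG hη hτ (fun i s => γ i s ω) t hs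
  rwa [integral_add' (((i1.sub i2).sub i3).add i4) i5, integral_add' ((i1.sub i2).sub i3) i4,
    integral_sub' (i1.sub i2) i3, integral_sub' i1 i2, integral_const_mul, integral_const_mul,
    integral_const_mul, integral_const_mul, integral_const_mul] at h

theorem integral_totalMove_le (hγ : RandomDelays μ γ E ζ L) (G : PolymatrixGame V S) (η τ : ℝ)
    (t : ℕ) : ∫ ω, G.totalMove η τ (fun i s => γ i s ω) t ∂μ
      ≤ 4 * ∫ ω, kl (G.omwuBar η τ (fun i s => γ i s ω) (t + 1))
          (G.omwu η τ (fun i s => γ i s ω) t) ∂μ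
        + 2 * ∫ ω, G.symEntropy η τ (fun i s => γ i s ω) t ∂μ := by
  have i1 := (integrable_kl_omwuBar_succ_omwu hγ G η τ t).const_mul 4
  have i2 := (integrable_symEntropy hγ G η τ t).const_mul 2
  have h := integral_mono (integrable_totalMove hγ G η τ t) (i1.add i2)
    fun ω => G.totalMove_le η τ (fun i s => γ i s ω) t
  rwa [integral_add' i1 i2, integral_const_mul, integral_const_mul] at h

theorem integral_symEntropy_succ_le (hγ : RandomDelays μ γ E ζ L) (G : PolymatrixGame V S)
    {η : ℝ} (hη : 0 ≤ η) (τ : ℝ) (t : ℕ) :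
    ∫ ω, G.symEntropy η τ (fun i s => γ i s ω) (t + 1) ∂μ
      ≤ η ^ 2 * G.payoffNorm ^ 2 * ∫ ω, G.drift η τ (fun i s => γ i s ω) t ∂μ := by
  have h := integral_mono (integrable_symEntropy hγ G η τ (t + 1))
    ((integrable_drift hγ G η τ t).const_mul (η ^ 2 * G.payoffNorm ^ 2))
    fun ω => G.symEntropy_succ_le hη τ (fun i s => γ i s ω) t
  rwa [integral_const_mul] at h

theorem integral_kl_omwuBar_succ_le (hγ : RandomDelays μ γ E ζ L) (G : PolymatrixGame V S)
    {η : ℝ} (hη : 0 ≤ η) (τ : ℝ) (t : ℕ) {s : Profile S} (hs : ∀ i, IsPosDist (s i)) :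
    ∫ ω, kl s (G.omwuBar η τ (fun i s => γ i s ω) (t + 1)) ∂μ
      ≤ 2 * ∫ ω, kl s (G.omwu η τ (fun i s => γ i s ω) (t + 1)) ∂μ
        + 3 / 2 * (η ^ 2 * G.payoffNorm ^ 2 * ∫ ω, G.drift η τ (fun i s => γ i s ω) t ∂μ) := by
  have i1 := (integrable_omwu hγ G η τ (t + 1) (kl s)).const_mul 2
  have i2 := ((integrable_drift hγ G η τ t).const_mul (η ^ 2 * G.payoffNorm ^ 2)).const_mul (3 / 2)
  have h := integral_mono (integrable_omwuBar hγ G η τ (t + 1) (kl s)) (i1.add i2)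
    fun ω => G.kl_omwuBar_succ_le hη τ (fun i s => γ i s ω) t hs
  rwa [integral_add' i1 i2, integral_const_mul, integral_const_mul, integral_const_mul] at h

theorem integral_qreGap_le (hγ : RandomDelays μ γ E ζ L) {G : PolymatrixGame V S}
    (hG : G.IsZeroSum) (η : ℝ) {τ : ℝ} (hτ : 0 < τ) {s : Profile S} (hs : G.IsQRE τ s) (t : ℕ) :
    ∫ ω, G.qreGap τ (G.omwuBar η τ (fun i s => γ i s ω) t) ∂μ
      ≤ τ * ∫ ω, kl (G.omwuBar η τ (fun i s => γ i s ω) t) s ∂μ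
        + (G.dmax : ℝ) ^ 2 * G.payoffNorm ^ 2 / τ
          * ∫ ω, kl s (G.omwuBar η τ (fun i s => γ i s ω) t) ∂μ := by
  have i1 := (integrable_omwuBar hγ G η τ t fun π => kl π s).const_mul τ
  have i2 := (integrable_omwuBar hγ G η τ t (kl s)).const_mul
    ((G.dmax : ℝ) ^ 2 * G.payoffNorm ^ 2 / τ)
  have h := integral_mono (integrable_omwuBar hγ G η τ t (G.qreGap τ)) (i1.add i2)
    fun ω => qreGap_le hG hτ hs (G.omwuBar_isPosDist η τ (fun i s => γ i s ω) t)
  rwa [integral_add' i1 i2, integral_const_mul, integral_const_mul] at h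

/-- The master estimate: the entropy to the equilibrium, the entropy from the equilibrium and the
last drift bound decay together. -/
theorem integral_omwu_bound (hγ : RandomDelays μ γ E ζ L) {G : PolymatrixGame V S}
    (hG : G.IsZeroSum) {η τ : ℝ} (hη : 0 < η) (hτ : 0 < τ) {s : Profile S} (hs : G.IsQRE τ s)
    [Nonempty V] (hητ : η * τ ≤ 1 / 24) (hζ : 1 ≤ ζ * (1 - η * τ))
    (hstep : η / τ * G.payoffNorm ^ 2 * (G.dmax : ℝ) ^ 2 * (L + 1) ≤ 1 / 24) (n : ℕ) :
    ∫ ω, kl s (G.omwu η τ (fun i s => γ i s ω) (n + 1)) ∂μ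
      + η * τ / 2 * ∫ ω, kl (G.omwuBar η τ (fun i s => γ i s ω) (n + 1)) s ∂μ
      + 3 / 4 * (η ^ 2 * G.payoffNorm ^ 2 * ∫ ω, G.drift η τ (fun i s => γ i s ω) n ∂μ)
      ≤ (1 - η * τ) ^ (n + 1) * kl s uniform := by
  have hL0 : 0 ≤ L := hγ.hasSum.nonneg fun l =>
    mul_nonneg (pow_nonneg (zero_le_one.trans hγ.one_lt.le) l) (hγ.nonneg_E l)
  have ha0 : ∫ ω, kl s (G.omwu η τ (fun i s => γ i s ω) 0) ∂μ = kl s uniform := by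
    simp [omwu_zero]
  rw [← ha0]
  have hmove0 : ∀ t, 0 ≤ ∫ ω, G.totalMove η τ (fun i s => γ i s ω) t ∂μ := fun t =>
    integral_nonneg fun ω => Finset.sum_nonneg fun j _ => G.move_nonneg η τ _ t j
  have hlag := integral_totalLag_le hγ G η τ
  have hN := G.payoffNorm_nonneg
  -- The drift carries a further factor `η τ ≤ 1 / 24` compared with the cross term.
  have hc₁ : 3 * (η ^ 2 * G.payoffNorm ^ 2 * (G.dmax : ℝ) ^ 2) * (L + 1) ≤ 1 / 192 := by
    have e : 3 * (η ^ 2 * G.payoffNorm ^ 2 * (G.dmax : ℝ) ^ 2) * (L + 1)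
        = 3 * (η * τ) * (η / τ * G.payoffNorm ^ 2 * (G.dmax : ℝ) ^ 2 * (L + 1)) := by
      field_simp
    rw [e]
    have h0 : 0 ≤ η * τ := by positivity
    nlinarith
  refine discounted_bound (L := L) (E := E) (ζ := ζ)
    (a := fun t => ∫ ω, kl s (G.omwu η τ (fun i s => γ i s ω) t) ∂μ)
    (b := fun t => ∫ ω, kl (G.omwuBar η τ (fun i s => γ i s ω) (t + 1))
            (G.omwu η τ (fun i s => γ i s ω) t) ∂μ)
    (k := fun t => η * τ / 2 * ∫ ω, kl (G.omwuBar η τ (fun i s => γ i s ω) t) s ∂μ)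
    (x := fun t => ∫ ω, G.totalMove η τ (fun i s => γ i s ω) t ∂μ)
    (J := fun t => ∫ ω, G.symEntropy η τ (fun i s => γ i s ω) t ∂μ)
    (Y := fun t => η ^ 2 * G.payoffNorm ^ 2 * ∫ ω, G.drift η τ (fun i s => γ i s ω) t ∂μ)
    (M := fun t => ∑ l ∈ Finset.range t,
        E (l + 1) * ∫ ω, G.totalMove η τ (fun i s => γ i s ω) (t - 1 - l) ∂μ)
    (c₁ := 3 * (η ^ 2 * G.payoffNorm ^ 2 * (G.dmax : ℝ) ^ 2))
    (c₂ := η / τ * G.payoffNorm ^ 2 * (G.dmax : ℝ) ^ 2)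
    (by linarith) hζ hγ.nonneg_E hγ.hasSum (by positivity) hc₁ (by positivity) hstep
    (fun t => mul_nonneg (by positivity) (integral_nonneg fun ω =>
      kl_nonneg (G.omwuBar_isPosDist η τ _ t) hs.isPosDist)) hmove0
    (fun t => mul_nonneg (by positivity) (integral_nonneg fun ω =>
      (Finset.sum_nonneg fun i _ => sq_nonneg _).trans
        (G.sum_nbrDist_observed_sq_le η τ (fun i s => γ i s ω) t)))
    (fun t => rfl) (integral_totalMove_le hγ G η τ) (by simp [symEntropy_zero])
    (integral_symEntropy_succ_le hγ G hη.le τ) (fun t => ?_) (fun t => ?_) n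
  · rw [integral_drift_eq hγ]
    have h1 := hlag t
    have h2 := hlag (t + 1)
    have h3 := mul_le_mul_of_nonneg_left (add_le_add h1 h2)
      (show 0 ≤ η ^ 2 * G.payoffNorm ^ 2 * (3 * (G.dmax : ℝ)) by positivity)
    linarith
  · have h1 := integral_kl_omwu_succ_le hγ hG hη.le hτ hs t
    have h2 := mul_le_mul_of_nonneg_left (hlag (t + 1))
      (show 0 ≤ η / τ * G.payoffNorm ^ 2 * (G.dmax : ℝ) by positivity)
    linarith

end Expectation

end

end PolymatrixGame

open PolymatrixGame in
theorem theorem2 {V : Type*} {S : V → Type*} [Fintype V] [∀ i, Fintype (S i)]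
    [∀ i, Nonempty (S i)] (G : PolymatrixGame V S) (hG : G.IsZeroSum)
    {Ω : Type*} [MeasurableSpace Ω] (μ : Measure Ω) [IsProbabilityMeasure μ]
    (γ : V → ℕ → Ω → ℕ) (E : ℕ → ℝ) (ζ L : ℝ) (hγ : RandomDelays μ γ E ζ L)
    (τ η : ℝ) (hτ0 : 0 < τ) (hτ : τ < min 1 ((G.dmax : ℝ) * G.payoffNorm)) (hη0 : 0 < η)
    (hη : η ≤ min (τ / (24 * (G.dmax : ℝ) ^ 2 * G.payoffNorm ^ 2 * (L + 1)))
      ((ζ - 1) / (τ * ζ)))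
    (πstar : PolymatrixGame.Profile S) (hstar : G.IsQRE τ πstar) (T : ℕ) (hT : 1 ≤ T) :
    (Integrable (fun ω => PolymatrixGame.kl πstar
        (G.omwu η τ (fun i t => γ i t ω) T)) μ ∧
      ∫ ω, PolymatrixGame.kl πstar (G.omwu η τ (fun i t => γ i t ω) T) ∂μ
        ≤ (1 - η * τ) ^ T * PolymatrixGame.kl πstar PolymatrixGame.uniform) ∧
    (Integrable (fun ω => PolymatrixGame.kl πstar
        (G.omwuBar η τ (fun i t => γ i t ω) T)) μ ∧
      ∫ ω, PolymatrixGame.kl πstar (G.omwuBar η τ (fun i t => γ i t ω) T) ∂μ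
        ≤ 2 * (1 - η * τ) ^ T * PolymatrixGame.kl πstar PolymatrixGame.uniform) ∧
    (Integrable (fun ω => G.qreGap τ (G.omwuBar η τ (fun i t => γ i t ω) T)) μ ∧
      ∫ ω, G.qreGap τ (G.omwuBar η τ (fun i t => γ i t ω) T) ∂μ
        ≤ 4 * η⁻¹ * (1 - η * τ) ^ T * PolymatrixGame.kl πstar PolymatrixGame.uniform) := by
  obtain ⟨n, rfl⟩ : ∃ n, T = n + 1 := ⟨T - 1, by omega⟩
  have hτD : τ < (G.dmax : ℝ) * G.payoffNorm := hτ.trans_le (min_le_right _ _)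
  have hV : Nonempty V := by
    by_contra h
    rw [not_nonempty_iff] at h
    have : G.payoffNorm = 0 := Real.iSup_of_isEmpty _
    rw [this, mul_zero] at hτD
    linarith
  have hL0 : 0 ≤ L := hγ.hasSum.nonneg fun l =>
    mul_nonneg (pow_nonneg (zero_le_one.trans hγ.one_lt.le) l) (hγ.nonneg_E l)
  have hDA : 0 < (G.dmax : ℝ) * G.payoffNorm := hτ0.trans hτD
  have hη1 : η * (24 * ((G.dmax : ℝ) * G.payoffNorm) ^ 2 * (L + 1)) ≤ τ := by
    have h := hη.trans (min_le_left _ _)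
    rw [mul_assoc 24, ← mul_pow] at h
    exact (le_div_iff₀ (by positivity)).1 h
  have hητ : η * τ ≤ 1 / 24 := by
    have h1 : τ ^ 2 ≤ ((G.dmax : ℝ) * G.payoffNorm) ^ 2 * (L + 1) := by
      have := pow_le_pow_left₀ hτ0.le hτD.le 2
      nlinarith [sq_nonneg ((G.dmax : ℝ) * G.payoffNorm)]
    have h2 := mul_le_mul_of_nonneg_left h1 hη0.le
    nlinarith
  have hζ : 1 ≤ ζ * (1 - η * τ) := by
    have h := hη.trans (min_le_right _ _)
    have h1 := hγ.one_lt
    rw [le_div_iff₀ (by positivity)] at h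
    linarith
  have hstep : η / τ * G.payoffNorm ^ 2 * (G.dmax : ℝ) ^ 2 * (L + 1) ≤ 1 / 24 := by
    have e : η / τ * G.payoffNorm ^ 2 * (G.dmax : ℝ) ^ 2 * (L + 1)
        = η * (24 * ((G.dmax : ℝ) * G.payoffNorm) ^ 2 * (L + 1)) / τ * (1 / 24) := by
      field_simp
    rw [e]
    have := (div_le_one hτ0).2 hη1
    linarith
  have hs := hstar.isPosDist
  have hmain := integral_omwu_bound hγ hG hη0 hτ0 hstar hητ hζ hstep n
  have hbar := integral_kl_omwuBar_succ_le hγ G hη0.le τ n hs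
  have hgap := integral_qreGap_le hγ hG η hτ0 hstar (n + 1)
  have ha : 0 ≤ ∫ ω, kl πstar (G.omwu η τ (fun i t => γ i t ω) (n + 1)) ∂μ :=
    integral_nonneg fun ω => kl_nonneg hs (G.omwu_isPosDist η τ _ _)
  have hb : 0 ≤ ∫ ω, kl (G.omwuBar η τ (fun i t => γ i t ω) (n + 1)) πstar ∂μ :=
    integral_nonneg fun ω => kl_nonneg (G.omwuBar_isPosDist η τ _ _) hs
  have hb' : 0 ≤ ∫ ω, kl πstar (G.omwuBar η τ (fun i t => γ i t ω) (n + 1)) ∂μ :=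
    integral_nonneg fun ω => kl_nonneg hs (G.omwuBar_isPosDist η τ _ _)
  have hd : 0 ≤ η ^ 2 * G.payoffNorm ^ 2 * ∫ ω, G.drift η τ (fun i t => γ i t ω) n ∂μ :=
    mul_nonneg (by positivity) (integral_nonneg fun ω =>
      (Finset.sum_nonneg fun i _ => sq_nonneg _).trans
        (G.sum_nbrDist_observed_sq_le η τ (fun i s => γ i s ω) n))
  have hkb : 0 ≤ η * τ / 2 * ∫ ω, kl (G.omwuBar η τ (fun i t => γ i t ω) (n + 1)) πstar ∂μ :=
    mul_nonneg (by positivity) hb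
  have hbar' : ∫ ω, kl πstar (G.omwuBar η τ (fun i t => γ i t ω) (n + 1)) ∂μ
      ≤ 2 * (1 - η * τ) ^ (n + 1) * kl πstar uniform := by
    linarith
  refine ⟨⟨integrable_omwu hγ G η τ _ (kl πstar), by linarith⟩,
    ⟨integrable_omwuBar hγ G η τ _ (kl πstar), hbar'⟩,
    ⟨integrable_omwuBar hγ G η τ _ (G.qreGap τ), hgap.trans ?_⟩⟩
  rw [mul_assoc, mul_comm 4, mul_assoc, ← div_eq_inv_mul, le_div_iff₀ hη0]
  -- The coefficient of `kl πstar` in the gap bound is at most `1 / (24 η)`.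
  have hc : (G.dmax : ℝ) ^ 2 * G.payoffNorm ^ 2 / τ * η ≤ 1 / 24 := by
    have e : η / τ * G.payoffNorm ^ 2 * (G.dmax : ℝ) ^ 2 * (L + 1)
        = (G.dmax : ℝ) ^ 2 * G.payoffNorm ^ 2 / τ * η * (L + 1) := by ring
    rw [e] at hstep
    have : 0 ≤ (G.dmax : ℝ) ^ 2 * G.payoffNorm ^ 2 / τ * η := by positivity
    nlinarith
  have h1 := mul_le_mul_of_nonneg_right hc hb'
  linarith
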